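/- Let $0<\alpha<1$. Let $\mathrm{Lip}_0^\alpha=\mathrm{Lip}_0^\alpha[0,1]$ be the space of all $f:[0,1]\to\mathbb C$ with $f(0)=0$ and $\|f\|_\alpha:=\sup_{t\neq s}\frac{|f(t)-f(s)|}{|t-s|^\alpha}<\infty$, normed by $\|\cdot\|_\alpha$, and let $\mathrm{lip}_0^\alpha$ be its subspace of those $f$ with $\lim_{\delta\to0}\sup_{0<|t-s|\le\delta}\frac{|f(t)-f(s)|}{|t-s|^\alpha}=0$. For $\operatorname{Re}z>0$ put $$J(z)f(t)=\frac1{\Gamma(z)}\int_0^t(t-s)^{z-1}f(s)\,ds\qquad(t\in[0,1]).$$ For $0<\theta\le\pi/2$ let $\Sigma_\theta=\{z\ne0:|\arg z|<\theta\}$, and let $D_\pm=\{z\in\mathbb C:\operatorname{Re}z>0,\ \pm\operatorname{Im}z>0,\ |z|\le1\}$. Then each $J(z)$, $\operatorname{Re} z>0$, is a bounded linear operator on $\mathrm{Lip}_0^\alpha$, and the following hold. (i) $J$ is a holomorphic semigroup of angle $\pi/2$ on $\mathrm{Lip}_0^\alpha$: $z\mapsto J(z)$ is holomorphic on $\operatorname{Re}z>0$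 for the operator norm, $J(z+w)=J(z)J(w)$, and for every $\theta<\pi/2$ there are $M$ and $\omega\ge0$ with $\|J(z)\|\le Me^{\omega\operatorname{Re}z}$ on $\Sigma_\theta$. For $f\in\mathrm{Lip}_0^\alpha$ one has $J(r)f\to f$ in $\mathrm{Lip}_0^\alpha$ as $r\to0^+$ if and only if $f\in\mathrm{lip}_0^\alpha$. Each $J(z)$ maps $\mathrm{lip}_0^\alpha$ into itself, and the restriction of $J$ to $\mathrm{lip}_0^\alpha$ is a holomorphic $C_0$-semigroup of angle $\pi/2$: it has the properties just listed, and $J(z)f\to f$ as $z\to0$ in $\Sigma_\theta$, for all $f\in\mathrm{lip}_0^\alpha$ and $\theta<\pi/2$. (ii) $\sup_{z\in D_+}\|J(z)\|<\infty$ and $\sup_{z\in D_-}\|J(z)\|<\infty$ for the operator norm on $\mathrm{Lip}_0^\alpha$. Moreover, if $\operatorname{Re}z>0$ and $|z|\le\frac{1-\alpha}2$, then $$\|J(z)\|\le\frac1{|\Gamma(z)|}\Big(\frac5\alpha+\frac{2|z-1|}{1-\alpha}\Big)+\frac{1+2^{1+\alpha}}{|\Gamma(z+1)|}.$$ Consequently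 $J$ admits a boundary group on the imaginary axis (fractional integration of purely imaginary order): there is a $C_0$-group $(U(t))_{t\in\mathbb R}$ of bounded operators on $\mathrm{lip}_0^\alpha$ such that, for every $f\in\mathrm{lip}_0^\alpha$, $J(\varepsilon+it)f\to U(t)f$ in $\mathrm{lip}_0^\alpha$ as $\varepsilon\to0^+$, uniformly for $t$ in compact intervals; and if $A$ is the generator of the $C_0$-semigroup $(J(r))_{r>0}$ on $\mathrm{lip}_0^\alpha$, then the generator of $U$ is $iA$, with the same domain. -/

import Mathlib

open Filter Topology
open scoped NNReal unitInterval

noncomputable section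

/-! ### Hölder spaces on the unit interval -/

/-- The complex functions on `[0,1]` that are Hölder continuous of exponent `α` and vanish at `0`,
as a subspace of the space of all functions (no topology is meant here). -/
def lipZeroSubmodule (α : ℝ≥0) : Submodule ℂ (I → ℂ) where
  carrier := {f | MemHolder α f ∧ f 0 = 0}
  add_mem' := fun hf hg => ⟨hf.1.add hg.1, by simp [hf.2, hg.2]⟩
  zero_mem' := ⟨memHolder_zero, rfl⟩
  smul_mem' := fun _ _ hf => ⟨hf.1.smul, by simp [hf.2]⟩

/-- The space `Lip_0^α[0,1]`. It is a type of its own, so that its topology is the one of the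
Hölder norm below and not that of pointwise convergence. -/
def LipZero (α : ℝ≥0) : Type := ↥(lipZeroSubmodule α)

namespace LipZero

variable {α : ℝ≥0}

instance : AddCommGroup (LipZero α) := inferInstanceAs (AddCommGroup ↥(lipZeroSubmodule α))

instance : Module ℂ (LipZero α) := inferInstanceAs (Module ℂ ↥(lipZeroSubmodule α))

instance : CoeFun (LipZero α) (fun _ => I → ℂ) := ⟨fun f => f.1⟩

theorem memHolder (f : LipZero α) : MemHolder α (f : I → ℂ) := f.2.1

theorem apply_zero (f : LipZero α) : f 0 = 0 := f.2.2

theorem coe_add (f g : LipZero α) : ((f + g : LipZero α) : I → ℂ) = (f : I → ℂ) + g := rfl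

theorem coe_sub (f g : LipZero α) : ((f - g : LipZero α) : I → ℂ) = (f : I → ℂ) - g := rfl

theorem coe_smul (c : ℂ) (f : LipZero α) : ((c • f : LipZero α) : I → ℂ) = c • (f : I → ℂ) := rfl

theorem coe_zero : ((0 : LipZero α) : I → ℂ) = 0 := rfl

theorem coe_injective {f g : LipZero α} (h : (f : I → ℂ) = g) : f = g := Subtype.ext h

/-- The norm `‖f‖_α = sup_{t ≠ s} |f t - f s| / |t - s| ^ α`
(the least Hölder constant of `f`). -/
instance : Norm (LipZero α) := ⟨fun f => (nnHolderNorm α (f : I → ℂ) : ℝ)⟩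

theorem norm_def (f : LipZero α) : ‖f‖ = (nnHolderNorm α (f : I → ℂ) : ℝ) := rfl

theorem normedSpaceCore : NormedSpace.Core ℂ (LipZero α) where
  norm_nonneg f := NNReal.coe_nonneg _
  norm_smul c f := by
    rw [norm_def, norm_def, coe_smul, f.memHolder.nnHolderNorm_smul]
    simp
  norm_triangle f g := by
    rw [norm_def, norm_def, norm_def, coe_add]
    exact_mod_cast f.memHolder.nnHolderNorm_add_le g.memHolder
  norm_eq_zero_iff f := by
    rw [norm_def, NNReal.coe_eq_zero, f.memHolder.nnHolderNorm_eq_zero]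
    constructor
    · intro h
      refine coe_injective (funext fun t => ?_)
      rw [h t 0, f.apply_zero, coe_zero]
      rfl
    · rintro rfl
      intro x y
      rfl

instance : NormedAddCommGroup (LipZero α) := NormedAddCommGroup.ofCore normedSpaceCore

instance : NormedSpace ℂ (LipZero α) := NormedSpace.ofCore normedSpaceCore

theorem norm_apply_sub_le (f : LipZero α) (t s : I) :
    ‖f t - f s‖ ≤ ‖f‖ * |(t : ℝ) - s| ^ (α : ℝ) := by
  have h := f.memHolder.holderWith.dist_le t s
  rwa [dist_eq_norm, Subtype.dist_eq, Real.dist_eq] at h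

end LipZero

/-- The little Hölder space `lip_0^α[0,1]`: those `f` for which
`sup_{0 < |t - s| ≤ δ} |f t - f s| / |t - s| ^ α` tends to `0` as `δ → 0`.
It carries the norm of `Lip_0^α[0,1]`. -/
def littleLipZero (α : ℝ≥0) : Submodule ℂ (LipZero α) where
  carrier := {f | ∀ ε > 0, ∃ δ > 0, ∀ t s : I, 0 < |(t : ℝ) - s| → |(t : ℝ) - s| ≤ δ →
    ‖f t - f s‖ / |(t : ℝ) - s| ^ (α : ℝ) ≤ ε}
  add_mem' := by
    intro f g hf hg ε hε
    obtain ⟨δ, hδ, hf⟩ := hf (ε / 2) (half_pos hε)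
    obtain ⟨η, hη, hg⟩ := hg (ε / 2) (half_pos hε)
    refine ⟨min δ η, lt_min hδ hη, fun t s h0 h => ?_⟩
    have h1 := hf t s h0 (h.trans (min_le_left _ _))
    have h2 := hg t s h0 (h.trans (min_le_right _ _))
    have h3 : ‖(f + g) t - (f + g) s‖ ≤ ‖f t - f s‖ + ‖g t - g s‖ := by
      have : (f + g) t - (f + g) s = (f t - f s) + (g t - g s) := by
        simp only [LipZero.coe_add, Pi.add_apply]; ring
      rw [this]
      exact norm_add_le _ _
    calc ‖(f + g) t - (f + g) s‖ / |(t : ℝ) - s| ^ (α : ℝ)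
        ≤ (‖f t - f s‖ + ‖g t - g s‖) / |(t : ℝ) - s| ^ (α : ℝ) := by gcongr
      _ ≤ ε := by rw [add_div]; linarith
  zero_mem' := by
    intro ε hε
    exact ⟨1, one_pos, fun t s _ _ => by simpa [LipZero.coe_zero] using hε.le⟩
  smul_mem' := by
    intro c f hf ε hε
    obtain ⟨δ, hδ, hf⟩ := hf (ε / (‖c‖ + 1)) (by positivity)
    refine ⟨δ, hδ, fun t s h0 h => ?_⟩
    have h1 := hf t s h0 h
    have h2 : ‖(c • f) t - (c • f) s‖ = ‖c‖ * ‖f t - f s‖ := by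
      rw [← norm_mul, mul_sub]
      rfl
    rw [h2, mul_div_assoc]
    calc ‖c‖ * (‖f t - f s‖ / |(t : ℝ) - s| ^ (α : ℝ))
        ≤ ‖c‖ * (ε / (‖c‖ + 1)) := by gcongr
      _ ≤ (‖c‖ + 1) * (ε / (‖c‖ + 1)) := by gcongr; linarith
      _ = ε := by field_simp

/-! ### Fractional integration -/

/-- The Riemann–Liouville fractional integral of order `z`, for `0 < Re z`:
`J(z) f (t) = Γ(z)⁻¹ ∫_0^t (t - s)^(z - 1) f(s) ds`, with `t` in `[0,1]`. The function `f` is only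
evaluated on `[0,1]`; `Set.projIcc` turns the real number `s` into an element of `[0,1]`. -/
def riemannLiouville (z : ℂ) (f : I → ℂ) (t : I) : ℂ :=
  (Complex.Gamma z)⁻¹ *
    ∫ s in (0 : ℝ)..t, (((t : ℝ) - s : ℝ) : ℂ) ^ (z - 1) * f (Set.projIcc 0 1 zero_le_one s)

/-! ### Semigroups, holomorphic semigroups, boundary groups -/

/-- The open sector `{z ≠ 0 : |arg z| < θ}`. -/
def openSector (θ : ℝ) : Set ℂ := {z | z ≠ 0 ∧ |z.arg| < θ}

/-- The upper quarter disc `{Re z > 0, Im z > 0, |z| ≤ 1}`. -/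
def upperQuarterDisc : Set ℂ := {z | 0 < z.re ∧ 0 < z.im ∧ ‖z‖ ≤ 1}

/-- The lower quarter disc `{Re z > 0, Im z < 0, |z| ≤ 1}`. -/
def lowerQuarterDisc : Set ℂ := {z | 0 < z.re ∧ z.im < 0 ∧ ‖z‖ ≤ 1}

section Semigroups

variable {E : Type*} [NormedAddCommGroup E] [NormedSpace ℂ E]

/-- A holomorphic semigroup of angle `φ`, without any continuity at `0`: a family of bounded
operators on the sector of angle `φ` that is holomorphic for the operator norm, satisfies the
semigroup law, and is exponentially bounded on each smaller sector
(that is, `exp (-ω z) T(z)` is bounded there for some `ω`).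
The values of `T` outside the sector play no role. -/
structure IsHolomorphicSemigroup (φ : ℝ) (T : ℂ → E →L[ℂ] E) : Prop where
  map_add : ∀ z ∈ openSector φ, ∀ w ∈ openSector φ, T (z + w) = (T z).comp (T w)
  differentiableOn : DifferentiableOn ℂ T (openSector φ)
  bound : ∀ θ, 0 < θ → θ < φ → ∃ M ω : ℝ, 0 ≤ ω ∧
    ∀ z ∈ openSector θ, ‖T z‖ ≤ M * Real.exp (ω * z.re)

/-- A holomorphic `C_0`-semigroup of angle `φ`: moreover `T(z) x → x` as `z → 0` within each
smaller sector. -/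
structure IsHolomorphicC0Semigroup (φ : ℝ) (T : ℂ → E →L[ℂ] E) : Prop
    extends IsHolomorphicSemigroup φ T where
  tendsto_zero : ∀ θ, 0 < θ → θ < φ → ∀ x, Tendsto (fun z => T z x) (𝓝[openSector θ] 0) (𝓝 x)

/-- A `C_0`-group of bounded operators. -/
structure IsC0Group (U : ℝ → E →L[ℂ] E) : Prop where
  map_zero : U 0 = ContinuousLinearMap.id ℂ E
  map_add : ∀ s t, U (s + t) = (U s).comp (U t)
  continuous : ∀ x, Continuous fun t => U t x

/-- `x` lies in the domain of the generator `A` of the semigroup `(T(r))_{r > 0}`, and `A x = y`. -/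
def SemigroupGeneratorApply (T : ℂ → E →L[ℂ] E) (x y : E) : Prop :=
  Tendsto (fun r : ℝ => ((r⁻¹ : ℝ) : ℂ) • (T r x - x)) (𝓝[>] 0) (𝓝 y)

/-- `x` lies in the domain of the generator `B` of the group `(U(t))_{t ∈ ℝ}`, and `B x = y`. -/
def GroupGeneratorApply (U : ℝ → E →L[ℂ] E) (x y : E) : Prop :=
  Tendsto (fun t : ℝ => ((t⁻¹ : ℝ) : ℂ) • (U t x - x)) (𝓝[≠] 0) (𝓝 y)

/-- `U` is the boundary group on the imaginary axis of the semigroup `T` on the right half-plane: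
it is a `C_0`-group, `U(t) x = lim_{ε → 0+} T(ε + i t) x` uniformly for `t` in compact intervals,
and if `A` is the generator of `T` then the generator of `U` is `i A`, with the same domain. -/
structure IsBoundaryGroup (T : ℂ → E →L[ℂ] E) (U : ℝ → E →L[ℂ] E) : Prop where
  isC0Group : IsC0Group U
  tendstoUniformlyOn : ∀ x, ∀ R : ℝ,
    TendstoUniformlyOn (fun (ε : ℝ) (t : ℝ) => T (ε + t * Complex.I) x) (fun t => U t x)
      (𝓝[>] 0) (Set.Icc (-R) R)
  generator : ∀ x y, GroupGeneratorApply U x y ↔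
    ∃ y', SemigroupGeneratorApply T x y' ∧ y = Complex.I • y'

end Semigroups

end

noncomputable section

open MeasureTheory Set

namespace LipZero

variable {α : ℝ≥0}

/-! ### Basic properties of the Hölder spaces -/

/-! Extending `f` by `0` to the left of `0` turns `J(z)` into convolution over the fixed interval
`(0,1]` with the kernel `u ^ (z - 1) / Γ(z)`. Translations do not increase Hölder constants, so an
integrable kernel gives a bounded operator, with norm at most the `L¹` norm of the kernel. The
semigroup law is associativity of convolution together with the Beta integral, and holomorphy is a
second-order Taylor estimate of the kernel in `L¹`.

The `L¹` norm is `1 / (Re z · |Γ(z)|)`, which blows up at the imaginary axis. The decisive estimate,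
`norm_cpowOp_apply_sub_le`, uses the regularity of `f` instead. In the difference of the values at
`t` and `s`, a constant is subtracted from `f` on each piece, and the near part is separated from
the far part. The constants then involve `1 / (Re z + α)`, `1 / (1 - Re z - α)` and `1 / |z|`, but
never `1 / Re z`. The factor `1 / |z|` is absorbed by `Γ(z + 1) = z Γ(z)`, and `1 / Γ` is entire, so
`J` is bounded on a small half disc. Powers of small pieces give `‖J(z)‖ ≤ C exp(ω |z|)` on the
whole half-plane, and `|z|` is comparable to `Re z` on each smaller sector.

The same estimate gains `Re z` in the Hölder exponent, so `J(z)` maps `Lip_0^α` into `lip_0^α`. That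
subspace is closed, so `J(r) f → f` forces `f` into it. Conversely, on `lip_0^α` small translations
are close to the identity, and `J(r)` is nearly an average of them.

The boundary group is then abstract (`IsHalfPlaneSemigroup`): boundedness on half discs and strong
continuity at `0` make orbits uniformly continuous there, hence extendable to the imaginary axis.
Both generators are characterised by one condition inside the half-plane, `OrbitDeriv`, and
holomorphy relates the real and the imaginary direction by the factor `i`. -/

theorem holderWith_of_bound {g : I → ℂ} {C : ℝ}
    (h : ∀ t s : I, ‖g t - g s‖ ≤ C * |(t : ℝ) - s| ^ (α : ℝ)) :
    HolderWith C.toNNReal α g := fun t s => by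
  have h1 : nndist (g t) (g s) ≤ C.toNNReal * nndist t s ^ (α : ℝ) := by
    rw [← NNReal.coe_le_coe]
    push_cast
    rw [dist_eq_norm, Subtype.dist_eq, Real.dist_eq]
    refine (h t s).trans ?_
    gcongr
    exact Real.le_coe_toNNReal C
  rw [edist_nndist, edist_nndist, ← ENNReal.coe_rpow_of_nonneg _ α.coe_nonneg, ← ENNReal.coe_mul,
    ENNReal.coe_le_coe]
  exact h1

/-- A function vanishing at `0` that satisfies a Hölder bound, as an element of `Lip_0^α`. -/
def ofBound (g : I → ℂ) (h0 : g 0 = 0) (C : ℝ)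
    (h : ∀ t s : I, ‖g t - g s‖ ≤ C * |(t : ℝ) - s| ^ (α : ℝ)) : LipZero α :=
  ⟨g, (holderWith_of_bound h).memHolder, h0⟩

theorem norm_le_of_bound (f : LipZero α) {C : ℝ} (hC : 0 ≤ C)
    (h : ∀ t s : I, ‖f t - f s‖ ≤ C * |(t : ℝ) - s| ^ (α : ℝ)) : ‖f‖ ≤ C := by
  have h2 := (holderWith_of_bound h).nnholderNorm_le
  rw [norm_def]
  calc (nnHolderNorm α (f : I → ℂ) : ℝ) ≤ (C.toNNReal : ℝ) := by exact_mod_cast h2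
    _ = C := Real.coe_toNNReal _ hC

theorem norm_le_of_bound_of_lt (f : LipZero α) {C : ℝ} (hC : 0 ≤ C)
    (h : ∀ t s : I, s < t → ‖f t - f s‖ ≤ C * ((t : ℝ) - s) ^ (α : ℝ)) : ‖f‖ ≤ C := by
  refine f.norm_le_of_bound hC fun t s => ?_
  rcases lt_trichotomy s t with hst | rfl | hst
  · rw [abs_of_pos (sub_pos.2 (Subtype.coe_lt_coe.2 hst))]
    exact h t s hst
  · simp only [sub_self, norm_zero]
    positivity
  · rw [norm_sub_rev, abs_sub_comm, abs_of_pos (sub_pos.2 (Subtype.coe_lt_coe.2 hst))]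
    exact h s t hst

theorem sub_apply (f g : LipZero α) (t : I) : (f - g) t = f t - g t := rfl

/-- The extension of a function in `Lip_0^α` to the real line, by `0` to the left of `0` and by the
value at `1` to the right of `1`. -/
def extend (f : LipZero α) (s : ℝ) : ℂ := f (projIcc 0 1 zero_le_one s)

theorem extend_of_nonpos (f : LipZero α) {s : ℝ} (hs : s ≤ 0) : f.extend s = 0 := by
  rw [extend, projIcc_of_le_left _ hs]
  exact f.apply_zero

theorem extend_coe (f : LipZero α) (t : I) : f.extend t = f t := by
  rw [extend, projIcc_val]

theorem extend_of_mem (f : LipZero α) {t : ℝ} (ht : t ∈ I) : f.extend t = f ⟨t, ht⟩ :=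
  f.extend_coe ⟨t, ht⟩

theorem extend_add (f g : LipZero α) (s : ℝ) : (f + g).extend s = f.extend s + g.extend s := rfl

theorem extend_smul (c : ℂ) (f : LipZero α) (s : ℝ) : (c • f).extend s = c * f.extend s := rfl

theorem abs_projIcc_sub_le (t s : ℝ) :
    |((projIcc 0 1 zero_le_one t : I) : ℝ) - (projIcc 0 1 zero_le_one s : I)| ≤ |t - s| :=
  abs_projIcc_sub_projIcc zero_le_one

theorem norm_extend_sub_le (f : LipZero α) (t s : ℝ) :
    ‖f.extend t - f.extend s‖ ≤ ‖f‖ * |t - s| ^ (α : ℝ) := by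
  refine (f.norm_apply_sub_le _ _).trans ?_
  exact mul_le_mul_of_nonneg_left (Real.rpow_le_rpow (abs_nonneg _) (abs_projIcc_sub_le t s) α.2)
    (norm_nonneg _)

theorem norm_extend_le (f : LipZero α) (t : ℝ) : ‖f.extend t‖ ≤ ‖f‖ := by
  have h := f.norm_apply_sub_le (projIcc 0 1 zero_le_one t) 0
  rw [f.apply_zero, sub_zero] at h
  refine h.trans (mul_le_of_le_one_right (norm_nonneg _) ?_)
  refine Real.rpow_le_one (abs_nonneg _) ?_ α.2
  rw [abs_le]
  have h1 := (projIcc (0 : ℝ) 1 zero_le_one t).2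
  constructor <;> simp <;> linarith [h1.1, h1.2]

theorem norm_apply_le (f : LipZero α) (t : I) : ‖f t‖ ≤ ‖f‖ := by
  rw [← extend_coe]
  exact f.norm_extend_le t

theorem continuous_extend (hα : 0 < α) (f : LipZero α) : Continuous f.extend :=
  (f.memHolder.holderWith.continuous hα).comp continuous_projIcc

theorem exists_norm_extend_sub_le {f : LipZero α} (hf : f ∈ littleLipZero α) {ε : ℝ} (hε : 0 < ε) :
    ∃ δ > 0, ∀ t s : ℝ, |t - s| ≤ δ → ‖f.extend t - f.extend s‖ ≤ ε * |t - s| ^ (α : ℝ) := by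
  obtain ⟨δ, hδ, h⟩ := hf ε hε
  refine ⟨δ, hδ, fun t s hts => ?_⟩
  have h1 := abs_projIcc_sub_le t s
  rcases (abs_nonneg (((projIcc 0 1 zero_le_one t : I) : ℝ) -
    (projIcc 0 1 zero_le_one s : I))).eq_or_lt with h0 | h0
  · have h2 : projIcc (0 : ℝ) 1 zero_le_one t = projIcc 0 1 zero_le_one s :=
      Subtype.ext (sub_eq_zero.1 (abs_eq_zero.1 h0.symm))
    rw [extend, extend, h2, sub_self, norm_zero]
    positivity
  · have h2 := h _ _ h0 (h1.trans hts)
    rw [div_le_iff₀ (by positivity)] at h2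
    refine h2.trans ?_
    gcongr

theorem mem_littleLipZero_of_rpow_bound {f : LipZero α} {K β : ℝ} (hβ : 0 < β)
    (h : ∀ t s : I, s < t → ‖f t - f s‖ ≤ K * ((t : ℝ) - s) ^ (α + β : ℝ)) :
    f ∈ littleLipZero α := by
  have h' : ∀ t s : I, 0 < |(t : ℝ) - s| →
      ‖f t - f s‖ ≤ K * |(t : ℝ) - s| ^ (α + β : ℝ) := by
    intro t s hts
    rcases lt_trichotomy s t with hst | rfl | hst
    · rw [abs_of_pos (sub_pos.2 (Subtype.coe_lt_coe.2 hst))]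
      exact h t s hst
    · simp at hts
    · rw [norm_sub_rev, abs_sub_comm, abs_of_pos (sub_pos.2 (Subtype.coe_lt_coe.2 hst))]
      exact h s t hst
  intro ε hε
  have hK : 0 < |K| + 1 := by positivity
  -- This `δ` makes `δ ^ β = ε / (|K| + 1)`, so the surplus power `β` swallows the constant; the `+
  -- 1` avoids division by zero.
  refine ⟨(ε / (|K| + 1)) ^ β⁻¹, by positivity, fun t s h0 hδ => ?_⟩
  rw [div_le_iff₀ (by positivity)]
  refine (h' t s h0).trans ?_
  rw [Real.rpow_add h0]
  have h1 : |(t : ℝ) - s| ^ β ≤ ε / (|K| + 1) := by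
    calc |(t : ℝ) - s| ^ β ≤ ((ε / (|K| + 1)) ^ β⁻¹) ^ β := by gcongr
      _ = ε / (|K| + 1) := by
        rw [← Real.rpow_mul (by positivity), inv_mul_cancel₀ hβ.ne', Real.rpow_one]
  have h2 : K * |(t : ℝ) - s| ^ β ≤ ε := by
    calc K * |(t : ℝ) - s| ^ β ≤ (|K| + 1) * (ε / (|K| + 1)) := by
          gcongr
          linarith [le_abs_self K]
      _ = ε := by field_simp
  calc K * (|(t : ℝ) - s| ^ (α : ℝ) * |(t : ℝ) - s| ^ β)
      = (K * |(t : ℝ) - s| ^ β) * |(t : ℝ) - s| ^ (α : ℝ) := by ring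
    _ ≤ ε * |(t : ℝ) - s| ^ (α : ℝ) := by gcongr

theorem isClosed_littleLipZero : IsClosed (littleLipZero α : Set (LipZero α)) := by
  rw [← isSeqClosed_iff_isClosed]
  intro u f hu huf ε hε
  have h1 : ∀ᶠ n in atTop, ‖u n - f‖ < ε / 2 := by
    have := (tendsto_iff_norm_sub_tendsto_zero.1 huf)
    exact this.eventually_lt_const (half_pos hε)
  obtain ⟨n, hn⟩ := h1.exists
  obtain ⟨δ, hδ, h⟩ := hu n (ε / 2) (half_pos hε)
  refine ⟨δ, hδ, fun t s h0 hts => ?_⟩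
  have h2 := h t s h0 hts
  have hp : 0 < |(t : ℝ) - s| ^ (α : ℝ) := by positivity
  rw [div_le_iff₀ hp] at h2 ⊢
  have h3 := (u n - f).norm_apply_sub_le t s
  have h4 : f t - f s = (u n t - u n s) - ((u n - f) t - (u n - f) s) := by
    rw [sub_apply, sub_apply]; ring
  calc ‖f t - f s‖ ≤ ‖u n t - u n s‖ + ‖(u n - f) t - (u n - f) s‖ := by
        rw [h4]; exact norm_sub_le _ _
    _ ≤ ε / 2 * |(t : ℝ) - s| ^ (α : ℝ) + ε / 2 * |(t : ℝ) - s| ^ (α : ℝ) := by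
        gcongr
        exact h3.trans (by gcongr)
    _ = ε * |(t : ℝ) - s| ^ (α : ℝ) := by ring

instance : CompleteSpace (LipZero α) := by
  refine Metric.complete_of_cauchySeq_tendsto fun u hu => ?_
  have hpt : ∀ t : I, ∃ y, Tendsto (fun n => u n t) atTop (𝓝 y) := by
    intro t
    refine cauchySeq_tendsto_of_complete ?_
    rw [Metric.cauchySeq_iff] at hu ⊢
    intro ε hε
    obtain ⟨N, hN⟩ := hu ε hε
    refine ⟨N, fun m hm n hn => lt_of_le_of_lt ?_ (hN m hm n hn)⟩
    rw [dist_eq_norm, dist_eq_norm, ← sub_apply]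
    exact norm_apply_le _ t
  choose g hg using hpt
  -- The Cauchy estimate in the Hölder norm survives the pointwise limit in the second index.
  have hlim : ∀ ε > 0, ∃ N, ∀ n ≥ N, ∀ t s : I,
      ‖(u n t - g t) - (u n s - g s)‖ ≤ ε * |(t : ℝ) - s| ^ (α : ℝ) := by
    intro ε hε
    obtain ⟨N, hN⟩ := Metric.cauchySeq_iff.1 hu ε hε
    refine ⟨N, fun n hn t s => ?_⟩
    refine le_of_tendsto (((tendsto_const_nhds.sub (hg t)).sub
      (tendsto_const_nhds.sub (hg s))).norm) ?_
    filter_upwards [eventually_ge_atTop N] with m hm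
    have h1 := (u n - u m).norm_apply_sub_le t s
    rw [sub_apply, sub_apply] at h1
    refine h1.trans ?_
    gcongr
    rw [← dist_eq_norm]
    exact (hN n hn m hm).le
  have hg0 : g 0 = 0 := by
    refine tendsto_nhds_unique (hg 0) ?_
    simp only [apply_zero]
    exact tendsto_const_nhds
  obtain ⟨N, hN⟩ := hlim 1 one_pos
  have hgb : ∀ t s : I, ‖g t - g s‖ ≤ (‖u N‖ + 1) * |(t : ℝ) - s| ^ (α : ℝ) := by
    intro t s
    have h1 : g t - g s = (u N t - u N s) - ((u N t - g t) - (u N s - g s)) := by ring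
    rw [h1, add_mul]
    exact (norm_sub_le _ _).trans (add_le_add ((u N).norm_apply_sub_le t s) (hN N le_rfl t s))
  refine ⟨ofBound g hg0 _ hgb, ?_⟩
  rw [tendsto_iff_norm_sub_tendsto_zero, Metric.tendsto_atTop]
  intro ε hε
  obtain ⟨M, hM⟩ := hlim (ε / 2) (half_pos hε)
  refine ⟨M, fun n hn => ?_⟩
  rw [dist_zero_right, norm_norm]
  exact (norm_le_of_bound _ (half_pos hε).le (hM n hn)).trans_lt (half_lt_self hε)

/-! ### Convolution operators -/

theorem integrableOn_mul_extend (hα : 0 < α) {κ : ℝ → ℂ} {S : Set ℝ} (hκ : IntegrableOn κ S)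
    (f : LipZero α) {φ : ℝ → ℝ} (hφ : Continuous φ) :
    IntegrableOn (fun u => κ u * f.extend (φ u)) S :=
  Integrable.mul_bdd (c := ‖f‖) hκ
    ((f.continuous_extend hα).comp hφ).aestronglyMeasurable
    (Eventually.of_forall fun _ => f.norm_extend_le _)

/-- Translating both points by `u` leaves their distance unchanged, so the Hölder bound of `f` comes
out of the integral and only the `L¹` norm of the kernel remains. -/
theorem norm_integral_mul_sub_le {κ : ℝ → ℂ} {S : Set ℝ}
    (hκ : IntegrableOn κ S) (f : LipZero α) (t s : ℝ) :
    ‖∫ u in S, κ u * (f.extend (t - u) - f.extend (s - u))‖ ≤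
      (∫ u in S, ‖κ u‖) * ‖f‖ * |t - s| ^ (α : ℝ) := by
  rw [mul_assoc, ← integral_mul_const]
  refine norm_integral_le_of_norm_le (hκ.norm.mul_const _) (Eventually.of_forall fun u => ?_)
  rw [norm_mul]
  gcongr
  have := f.norm_extend_sub_le (t - u) (s - u)
  rwa [sub_sub_sub_cancel_right] at this

theorem integral_mul_extend_sub (hα : 0 < α) {κ : ℝ → ℂ} {S : Set ℝ} (hκ : IntegrableOn κ S)
    (f : LipZero α) (t s : ℝ) :
    (∫ u in S, κ u * f.extend (t - u)) - ∫ u in S, κ u * f.extend (s - u) =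
      ∫ u in S, κ u * (f.extend (t - u) - f.extend (s - u)) := by
  simp_rw [mul_sub]
  exact (integral_sub (integrableOn_mul_extend hα hκ f (by fun_prop))
    (integrableOn_mul_extend hα hκ f (by fun_prop))).symm

/-- The operator `f ↦ ∫_0^1 κ(u) f(· - u) du` of convolution with an integrable kernel. -/
def kernelOp (hα : 0 < α) (κ : ℝ → ℂ) (hκ : IntegrableOn κ (Ioc 0 1)) :
    LipZero α →L[ℂ] LipZero α :=
  LinearMap.mkContinuous
    { toFun := fun f => ofBound (fun t => ∫ u in Ioc 0 1, κ u * f.extend ((t : ℝ) - u))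
        (by
          refine setIntegral_eq_zero_of_forall_eq_zero fun u hu => ?_
          rw [extend_of_nonpos _ (by simpa using hu.1.le), mul_zero])
        ((∫ u in Ioc 0 1, ‖κ u‖) * ‖f‖)
        (fun t s => by
          rw [integral_mul_extend_sub hα hκ]
          exact norm_integral_mul_sub_le hκ f t s)
      map_add' := fun f g => coe_injective (funext fun t => by
        change ∫ u in Ioc 0 1, κ u * (f + g).extend ((t : ℝ) - u) =
          (∫ u in Ioc 0 1, κ u * f.extend ((t : ℝ) - u)) +
          ∫ u in Ioc 0 1, κ u * g.extend ((t : ℝ) - u)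
        simp_rw [extend_add, mul_add]
        exact integral_add (integrableOn_mul_extend hα hκ f (by fun_prop))
          (integrableOn_mul_extend hα hκ g (by fun_prop)))
      map_smul' := fun c f => coe_injective (funext fun t => by
        change ∫ u in Ioc 0 1, κ u * (c • f).extend ((t : ℝ) - u) =
          c * ∫ u in Ioc 0 1, κ u * f.extend ((t : ℝ) - u)
        simp_rw [extend_smul, mul_left_comm]
        exact integral_const_mul _ _) }
    (∫ u in Ioc 0 1, ‖κ u‖)
    (fun f => norm_le_of_bound _ (by positivity) fun t s => by
      change ‖(∫ u in Ioc 0 1, κ u * f.extend ((t : ℝ) - u)) -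
        ∫ u in Ioc 0 1, κ u * f.extend ((s : ℝ) - u)‖ ≤ _
      rw [integral_mul_extend_sub hα hκ]
      exact norm_integral_mul_sub_le hκ f t s)

theorem kernelOp_apply (hα : 0 < α) {κ : ℝ → ℂ} (hκ : IntegrableOn κ (Ioc 0 1))
    (f : LipZero α) (t : I) :
    kernelOp hα κ hκ f t = ∫ u in Ioc 0 1, κ u * f.extend ((t : ℝ) - u) := rfl

theorem norm_kernelOp_le (hα : 0 < α) {κ : ℝ → ℂ} (hκ : IntegrableOn κ (Ioc 0 1)) :
    ‖kernelOp hα κ hκ‖ ≤ ∫ u in Ioc 0 1, ‖κ u‖ :=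
  LinearMap.mkContinuous_norm_le _ (by positivity) _

theorem kernelOp_sub (hα : 0 < α) {κ μ : ℝ → ℂ} (hκ : IntegrableOn κ (Ioc 0 1))
    (hμ : IntegrableOn μ (Ioc 0 1)) :
    kernelOp hα κ hκ - kernelOp hα μ hμ = kernelOp hα (κ - μ) (hκ.sub hμ) := by
  refine ContinuousLinearMap.ext fun f => coe_injective (funext fun t => ?_)
  change (∫ u in Ioc 0 1, κ u * f.extend ((t : ℝ) - u)) -
    (∫ u in Ioc 0 1, μ u * f.extend ((t : ℝ) - u)) =
    ∫ u in Ioc 0 1, (κ u - μ u) * f.extend ((t : ℝ) - u)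
  simp_rw [sub_mul]
  exact (integral_sub (integrableOn_mul_extend hα hκ f (by fun_prop))
    (integrableOn_mul_extend hα hμ f (by fun_prop))).symm

theorem smul_kernelOp (hα : 0 < α) (c : ℂ) {κ : ℝ → ℂ} (hκ : IntegrableOn κ (Ioc 0 1))
    (hc : IntegrableOn (c • κ) (Ioc 0 1)) :
    c • kernelOp hα κ hκ = kernelOp hα (c • κ) hc := by
  refine ContinuousLinearMap.ext fun f => coe_injective (funext fun t => ?_)
  change c * (∫ u in Ioc 0 1, κ u * f.extend ((t : ℝ) - u)) =
    ∫ u in Ioc 0 1, (c * κ u) * f.extend ((t : ℝ) - u)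
  simp_rw [mul_assoc]
  exact (integral_const_mul _ _).symm

/-! ### The Riemann–Liouville kernel -/

theorem norm_ofReal_cpow_sub_one {u : ℝ} (hu : 0 < u) (z : ℂ) :
    ‖(u : ℂ) ^ (z - 1)‖ = u ^ (z.re - 1) := by
  rw [Complex.norm_cpow_eq_rpow_re_of_pos hu, Complex.sub_re, Complex.one_re]

theorem intervalIntegrable_cpow_sub_one {z : ℂ} (hz : 0 < z.re) (a b : ℝ) :
    IntervalIntegrable (fun u : ℝ => (u : ℂ) ^ (z - 1)) volume a b :=
  intervalIntegral.intervalIntegrable_cpow' (by simpa using hz)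

theorem integrableOn_cpow_sub_one {z : ℂ} (hz : 0 < z.re) :
    IntegrableOn (fun u : ℝ => (u : ℂ) ^ (z - 1)) (Ioc 0 1) :=
  (intervalIntegrable_iff_integrableOn_Ioc_of_le zero_le_one).1
    (intervalIntegrable_cpow_sub_one hz 0 1)

theorem integrableOn_rpow_sub_one {x : ℝ} (hx : 0 < x) :
    IntegrableOn (fun u : ℝ => u ^ (x - 1)) (Ioc 0 1) :=
  (intervalIntegrable_iff_integrableOn_Ioc_of_le zero_le_one).1
    (intervalIntegral.intervalIntegrable_rpow' (by linarith))

/-- Convolution with `u ^ (z - 1)`, for `0 < Re z`. -/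
def cpowOp (hα : 0 < α) (z : ℂ) : LipZero α →L[ℂ] LipZero α :=
  if hz : 0 < z.re then kernelOp hα _ (integrableOn_cpow_sub_one hz) else 0

theorem cpowOp_of_pos (hα : 0 < α) {z : ℂ} (hz : 0 < z.re) :
    cpowOp hα z = kernelOp hα _ (integrableOn_cpow_sub_one hz) := dif_pos hz

theorem cpowOp_apply (hα : 0 < α) {z : ℂ} (hz : 0 < z.re) (f : LipZero α) (t : I) :
    cpowOp hα z f t = ∫ u : ℝ in Ioc 0 1, (u : ℂ) ^ (z - 1) * f.extend ((t : ℝ) - u) := by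
  rw [cpowOp_of_pos hα hz, kernelOp_apply]

/-- The fractional integral of order `z` on `Lip_0^α`, for `0 < Re z`. -/
def fracInt (hα : 0 < α) (z : ℂ) : LipZero α →L[ℂ] LipZero α :=
  (Complex.Gamma z)⁻¹ • cpowOp hα z

theorem fracInt_apply (hα : 0 < α) {z : ℂ} (hz : 0 < z.re) (f : LipZero α) (t : I) :
    fracInt hα z f t =
      (Complex.Gamma z)⁻¹ * ∫ u : ℝ in Ioc 0 1, (u : ℂ) ^ (z - 1) * f.extend ((t : ℝ) - u) := by
  rw [← cpowOp_apply hα hz]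
  rfl

/-- Substitute `u = t - s`. The surplus range `t < u ≤ 1` contributes nothing, because the extension
of `f` vanishes to the left of `0`. -/
theorem fracInt_eq_riemannLiouville (hα : 0 < α) {z : ℂ} (hz : 0 < z.re) (f : LipZero α) (t : I) :
    fracInt hα z f t = riemannLiouville z f t := by
  rw [fracInt_apply hα hz, riemannLiouville]
  congr 1
  have h1 := intervalIntegral.integral_comp_sub_left (a := 0) (b := t)
    (fun u : ℝ => (u : ℂ) ^ (z - 1) * f.extend ((t : ℝ) - u)) (t : ℝ)
  simp only [sub_sub_cancel, sub_self, sub_zero] at h1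
  refine Eq.trans ?_ h1.symm
  rw [intervalIntegral.integral_of_le t.2.1]
  refine setIntegral_eq_of_subset_of_forall_sdiff_eq_zero measurableSet_Ioc
    (Ioc_subset_Ioc_right t.2.2) fun u hu => ?_
  have hu' : (t : ℝ) < u := by
    by_contra! h
    exact hu.2 ⟨hu.1.1, h⟩
  rw [extend_of_nonpos _ (by linarith), mul_zero]

/-! ### The semigroup law -/

/-- The kernel `u ^ (z - 1)` on `(0,1]`, extended by `0`. -/
def cpowKernel (z : ℂ) : ℝ → ℂ := indicator (Ioc 0 1) fun u : ℝ => (u : ℂ) ^ (z - 1)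

theorem integrable_cpowKernel {z : ℂ} (hz : 0 < z.re) : Integrable (cpowKernel z) :=
  (integrable_indicator_iff measurableSet_Ioc).2 (integrableOn_cpow_sub_one hz)

theorem cpowKernel_of_nonpos (z : ℂ) {u : ℝ} (hu : u ≤ 0) : cpowKernel z u = 0 :=
  indicator_of_notMem (fun h => h.1.not_ge hu) _

theorem cpowKernel_of_mem (z : ℂ) {u : ℝ} (hu : u ∈ Ioc (0 : ℝ) 1) :
    cpowKernel z u = (u : ℂ) ^ (z - 1) := indicator_of_mem hu _

theorem extend_cpowOp (hα : 0 < α) {z : ℂ} (hz : 0 < z.re) (f : LipZero α) {t : ℝ} (ht : t ≤ 1) :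
    (cpowOp hα z f).extend t = ∫ u, cpowKernel z u * f.extend (t - u) := by
  rcases le_or_gt t 0 with h0 | h0
  · rw [extend_of_nonpos _ h0, eq_comm]
    refine integral_eq_zero_of_ae (Eventually.of_forall fun u => ?_)
    rcases le_or_gt u 0 with hu | hu
    · simp [cpowKernel_of_nonpos z hu]
    · simp [extend_of_nonpos f (show t - u ≤ 0 by linarith)]
  · rw [extend_of_mem _ ⟨h0.le, ht⟩, cpowOp_apply hα hz, ← integral_indicator measurableSet_Ioc]
    refine integral_congr_ae (Eventually.of_forall fun u => ?_)
    by_cases hu : u ∈ Ioc (0 : ℝ) 1 <;> simp [cpowKernel, hu]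

/-- For `0 < u ≤ 1` only `s` in `(0,u)` matters, where neither truncation at `1` is felt; what
remains is a rescaled Beta integral. -/
theorem integral_cpowKernel_mul (z w : ℂ) {u : ℝ} (hu : u ≤ 1) :
    ∫ s, cpowKernel z s * cpowKernel w (u - s) =
      Complex.betaIntegral z w * cpowKernel (z + w) u := by
  rcases le_or_gt u 0 with h0 | h0
  · rw [cpowKernel_of_nonpos _ h0, mul_zero]
    refine integral_eq_zero_of_ae (Eventually.of_forall fun s => ?_)
    rcases le_or_gt s 0 with hs | hs
    · simp [cpowKernel_of_nonpos z hs]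
    · simp [cpowKernel_of_nonpos w (show u - s ≤ 0 by linarith)]
  · rw [cpowKernel_of_mem _ ⟨h0, hu⟩, mul_comm, ← Complex.betaIntegral_scaled z w h0,
      intervalIntegral.integral_of_le h0.le, integral_Ioc_eq_integral_Ioo,
      ← integral_indicator measurableSet_Ioo]
    refine integral_congr_ae (Eventually.of_forall fun s => ?_)
    by_cases hs : s ∈ Ioo 0 u
    · simp only [indicator_of_mem hs]
      rw [cpowKernel_of_mem z ⟨hs.1, by linarith [hs.2]⟩,
        cpowKernel_of_mem w ⟨by linarith [hs.2], by linarith [hs.1]⟩]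
      push_cast
      rfl
    · simp only [indicator_of_notMem hs]
      rcases le_or_gt s 0 with h1 | h1
      · rw [cpowKernel_of_nonpos z h1, zero_mul]
      · have h2 : u ≤ s := by
          by_contra! h2
          exact hs ⟨h1, h2⟩
        rw [cpowKernel_of_nonpos w (by linarith), mul_zero]

theorem cpowOp_comp (hα : 0 < α) {z w : ℂ} (hz : 0 < z.re) (hw : 0 < w.re) :
    (cpowOp hα z).comp (cpowOp hα w) = Complex.betaIntegral z w • cpowOp hα (z + w) := by
  have hzw : 0 < (z + w).re := by rw [Complex.add_re]; positivity
  refine ContinuousLinearMap.ext fun f => coe_injective (funext fun t => ?_)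
  change cpowOp hα z (cpowOp hα w f) t = Complex.betaIntegral z w * cpowOp hα (z + w) f t
  rw [← extend_coe, ← extend_coe (cpowOp hα (z + w) f), extend_cpowOp hα hz _ t.2.2,
    extend_cpowOp hα hzw _ t.2.2, ← integral_const_mul]
  have hfb : ∀ x, ConvolutionExistsAt (cpowKernel w) f.extend x (ContinuousLinearMap.mul ℂ ℂ)
      volume := fun x =>
    Integrable.mul_bdd (c := ‖f‖) (integrable_cpowKernel hw)
      ((f.continuous_extend hα).comp (by fun_prop)).aestronglyMeasurable
      (Eventually.of_forall fun _ => f.norm_extend_le _)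
  have hassoc := convolution_assoc' (μ := volume) (ν := volume) (f := cpowKernel z)
    (g := cpowKernel w) (k := f.extend)
    (ContinuousLinearMap.mul ℂ ℂ) (ContinuousLinearMap.mul ℂ ℂ) (ContinuousLinearMap.mul ℂ ℂ)
    (ContinuousLinearMap.mul ℂ ℂ) (fun x y z => by simp [mul_assoc]) (x₀ := (t : ℝ))
    ((integrable_cpowKernel hz).ae_convolution_exists _ (integrable_cpowKernel hw))
    (Eventually.of_forall hfb)
    (by
      have h1 := Integrable.mul_bdd (c := ‖f‖) (g := fun p : ℝ × ℝ => f.extend ((t : ℝ) - p.1))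
        ((integrable_cpowKernel hz).convolution_integrand (ContinuousLinearMap.mul ℂ ℂ)
          (integrable_cpowKernel hw))
        ((f.continuous_extend hα).comp (by fun_prop)).aestronglyMeasurable
        (Eventually.of_forall fun _ => f.norm_extend_le _)
      refine h1.congr (Eventually.of_forall fun p => ?_)
      simp [Function.uncurry, mul_assoc])
  simp only [convolution_def, ContinuousLinearMap.mul_apply'] at hassoc
  calc ∫ u, cpowKernel z u * (cpowOp hα w f).extend ((t : ℝ) - u)
      = ∫ u, cpowKernel z u * ∫ v, cpowKernel w v * f.extend ((t : ℝ) - u - v) := by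
        refine integral_congr_ae (Eventually.of_forall fun u => ?_)
        rcases le_or_gt u 0 with hu | hu
        · simp [cpowKernel_of_nonpos z hu]
        · simp only
          rw [extend_cpowOp hα hw _ (by linarith [t.2.2])]
    _ = _ := hassoc.symm
    _ = _ := by
        refine integral_congr_ae (Eventually.of_forall fun u => ?_)
        -- For `u > 1` the convolution of the truncated kernels is not the truncated kernel, but
        -- there `t - u ≤ 0` and `f` vanishes.
        rcases le_or_gt u 1 with hu | hu
        · simp only
          rw [integral_cpowKernel_mul z w hu, mul_assoc]
        · simp [extend_of_nonpos f (show (t : ℝ) - u ≤ 0 by linarith [t.2.2])]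

theorem fracInt_add (hα : 0 < α) {z w : ℂ} (hz : 0 < z.re) (hw : 0 < w.re) :
    fracInt hα (z + w) = (fracInt hα z).comp (fracInt hα w) := by
  have hzw : 0 < (z + w).re := by rw [Complex.add_re]; positivity
  have h1 := Complex.Gamma_ne_zero_of_re_pos hz
  have h2 := Complex.Gamma_ne_zero_of_re_pos hw
  have h3 := Complex.Gamma_ne_zero_of_re_pos hzw
  rw [fracInt, fracInt, fracInt, ContinuousLinearMap.smul_comp, ContinuousLinearMap.comp_smul,
    cpowOp_comp hα hz hw, smul_smul, smul_smul]
  congr 1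
  have h4 := Complex.Gamma_mul_Gamma_eq_betaIntegral hz hw
  field_simp
  linear_combination h4

/-! ### Holomorphy -/

theorem integrableOn_log_mul_cpow {z : ℂ} (hz : 0 < z.re) :
    IntegrableOn (fun u : ℝ => (Real.log u : ℂ) * (u : ℂ) ^ (z - 1)) (Ioc 0 1) := by
  have hm : Measurable fun u : ℝ => (Real.log u : ℂ) * (u : ℂ) ^ (z - 1) :=
    (Complex.measurable_ofReal.comp Real.measurable_log).mul
      (Complex.measurable_ofReal.pow_const _)
  refine Integrable.mono' ((integrableOn_rpow_sub_one (half_pos hz)).const_mul (1 / (z.re / 2)))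
    hm.aestronglyMeasurable ((ae_restrict_iff' measurableSet_Ioc).2
      (Eventually.of_forall fun u hu => ?_))
  have h1 := Real.abs_log_mul_self_rpow_lt u (z.re / 2) hu.1 hu.2 (half_pos hz)
  rw [norm_mul, norm_ofReal_cpow_sub_one hu.1, Complex.norm_real, Real.norm_eq_abs]
  calc |Real.log u| * u ^ (z.re - 1)
      = |Real.log u * u ^ (z.re / 2)| * u ^ (z.re / 2 - 1) := by
        rw [abs_mul, abs_of_pos (Real.rpow_pos_of_pos hu.1 _), mul_assoc, ← Real.rpow_add hu.1]
        ring_nf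
    _ ≤ 1 / (z.re / 2) * u ^ (z.re / 2 - 1) :=
        mul_le_mul_of_nonneg_right h1.le (Real.rpow_pos_of_pos hu.1 _).le

/-- Apply `|exp w - 1 - w| ≤ |w|² exp |w|` with `w = h log u`. The exponent `Re z` is split into
four quarters: one absorbs `exp |w|`, two absorb `(log u)²`, and the last keeps the majorant
integrable at `0`. -/
theorem norm_cpow_add_sub_le {z h : ℂ} (hz : 0 < z.re) (hh : ‖h‖ ≤ z.re / 4) {u : ℝ}
    (hu : u ∈ Ioc (0 : ℝ) 1) :
    ‖(u : ℂ) ^ (z + h - 1) - (u : ℂ) ^ (z - 1) - h * ((Real.log u : ℂ) * (u : ℂ) ^ (z - 1))‖ ≤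
      ‖h‖ ^ 2 * ((4 / z.re) ^ 2 * u ^ (z.re / 4 - 1)) := by
  have hu0 : (u : ℂ) ≠ 0 := Complex.ofReal_ne_zero.2 hu.1.ne'
  set l := Real.log u with hl
  have hl0 : l ≤ 0 := Real.log_nonpos hu.1.le hu.2
  have h1 : (u : ℂ) ^ (z + h - 1) = Complex.exp (h * l) * (u : ℂ) ^ (z - 1) := by
    rw [show z + h - 1 = h + (z - 1) by ring, Complex.cpow_add _ _ hu0]
    congr 1
    rw [Complex.cpow_def_of_ne_zero hu0, ← Complex.ofReal_log hu.1.le, mul_comm]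
  have h2 : (u : ℂ) ^ (z + h - 1) - (u : ℂ) ^ (z - 1) - h * ((l : ℂ) * (u : ℂ) ^ (z - 1)) =
      (Complex.exp (h * l) - (1 + h * l)) * (u : ℂ) ^ (z - 1) := by
    rw [h1]; ring
  have h3 := Complex.norm_exp_sub_sum_le_norm_mul_exp (h * l) 2
  simp only [Finset.sum_range_succ, Finset.sum_range_zero, pow_zero, pow_one, Nat.factorial,
    Nat.cast_one, div_one, zero_add, mul_one] at h3
  have h4 : ‖h * (l : ℂ)‖ = ‖h‖ * |l| := by rw [norm_mul, Complex.norm_real, Real.norm_eq_abs]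
  rw [h2, norm_mul, norm_ofReal_cpow_sub_one hu.1]
  have h5 : Real.exp (‖h‖ * |l|) ≤ u ^ (-(z.re / 4)) := by
    rw [Real.rpow_def_of_pos hu.1, ← hl, abs_of_nonpos hl0]
    refine Real.exp_le_exp.2 ?_
    nlinarith
  have h6 := (Real.abs_log_mul_self_rpow_lt u (z.re / 4) hu.1 hu.2 (by positivity)).le
  rw [abs_mul, abs_of_pos (Real.rpow_pos_of_pos hu.1 _), ← hl] at h6
  have h7 : (|l| * u ^ (z.re / 4)) ^ 2 ≤ (4 / z.re) ^ 2 := by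
    refine pow_le_pow_left₀ (mul_nonneg (abs_nonneg _) (Real.rpow_pos_of_pos hu.1 _).le) (h6.trans (le_of_eq ?_)) 2
    field_simp
  calc ‖Complex.exp (h * l) - (1 + h * l)‖ * u ^ (z.re - 1)
      ≤ ((‖h‖ * |l|) ^ 2 * u ^ (-(z.re / 4))) * u ^ (z.re - 1) := by
        refine mul_le_mul_of_nonneg_right (h3.trans ?_) (Real.rpow_pos_of_pos hu.1 _).le
        rw [h4]
        gcongr
    _ = ‖h‖ ^ 2 * ((|l| * u ^ (z.re / 4)) ^ 2 * u ^ (z.re / 4 - 1)) := by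
        have h8 : u ^ (-(z.re / 4)) * u ^ (z.re - 1) =
            u ^ (z.re / 4) * u ^ (z.re / 4) * u ^ (z.re / 4 - 1) := by
          rw [← Real.rpow_add hu.1, ← Real.rpow_add hu.1, ← Real.rpow_add hu.1]
          ring_nf
        rw [mul_assoc, h8]
        ring
    _ ≤ _ := by
        have := Real.rpow_pos_of_pos hu.1 (z.re / 4 - 1)
        gcongr

theorem hasDerivAt_cpowOp (hα : 0 < α) {z : ℂ} (hz : 0 < z.re) :
    HasDerivAt (cpowOp hα) (kernelOp hα _ (integrableOn_log_mul_cpow hz)) z := by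
  rw [hasDerivAt_iff_isLittleO_nhds_zero]
  have hint := (integrableOn_rpow_sub_one (show 0 < z.re / 4 by positivity)).const_mul
    ((4 / z.re) ^ 2)
  have hO : (fun h : ℂ => cpowOp hα (z + h) - cpowOp hα z -
      h • kernelOp hα _ (integrableOn_log_mul_cpow hz)) =O[𝓝 0] fun h => ‖h‖ ^ 2 := by
    refine Asymptotics.IsBigO.of_bound
      (∫ u in Ioc (0 : ℝ) 1, (4 / z.re) ^ 2 * u ^ (z.re / 4 - 1)) ?_
    filter_upwards [Metric.closedBall_mem_nhds (0 : ℂ) (show 0 < z.re / 4 by positivity)] with h hh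
    rw [mem_closedBall_zero_iff] at hh
    have hzh : 0 < (z + h).re := by
      have := (abs_le.1 ((Complex.abs_re_le_norm h).trans hh)).1
      rw [Complex.add_re]
      linarith
    have hsm : IntegrableOn (h • fun u : ℝ => (Real.log u : ℂ) * (u : ℂ) ^ (z - 1)) (Ioc 0 1) :=
      Integrable.smul h (integrableOn_log_mul_cpow hz)
    rw [cpowOp_of_pos hα hzh, cpowOp_of_pos hα hz, smul_kernelOp hα h _ hsm,
      kernelOp_sub, kernelOp_sub, norm_pow, norm_norm, mul_comm, ← integral_const_mul]
    refine (norm_kernelOp_le hα _).trans ?_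
    refine setIntegral_mono_on (Integrable.norm (((integrableOn_cpow_sub_one hzh).sub
      (integrableOn_cpow_sub_one hz)).sub hsm))
      (hint.const_mul _) measurableSet_Ioc fun u hu => ?_
    exact norm_cpow_add_sub_le hz hh hu
  refine hO.trans_isLittleO ?_
  exact (Asymptotics.isLittleO_norm_pow_id one_lt_two)

theorem differentiableAt_fracInt (hα : 0 < α) {z : ℂ} (hz : 0 < z.re) :
    DifferentiableAt ℂ (fracInt hα) z :=
  (Complex.differentiable_one_div_Gamma z).smul (hasDerivAt_cpowOp hα hz).differentiableAt

/-! ### Increments of fractional integrals of small order -/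

/-- Mean value inequality: since `Re w ≤ 1`, the modulus of the derivative is largest at the left
endpoint `a`. -/
theorem norm_cpow_sub_cpow_le {w : ℂ} (hw : w.re ≤ 1) {a b : ℝ} (ha : 0 < a) (hab : a ≤ b) :
    ‖(b : ℂ) ^ w - (a : ℂ) ^ w‖ ≤ ‖w‖ * a ^ (w.re - 1) * (b - a) := by
  have h1 := (convex_Icc a b).norm_image_sub_le_of_norm_hasDerivWithin_le
    (f := fun y : ℝ => (y : ℂ) ^ w) (f' := fun y : ℝ => w * (y : ℂ) ^ (w - 1))
    (C := ‖w‖ * a ^ (w.re - 1)) (x := a) (y := b)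
    (fun y hy => by
      have hy0 : 0 < y := ha.trans_le hy.1
      have := ((hasDerivAt_id (y : ℂ)).cpow_const (c := w)
        (by simpa using hy0)).comp_ofReal
      simpa using this.hasDerivWithinAt)
    (fun y hy => by
      have hy0 : 0 < y := ha.trans_le hy.1
      rw [norm_mul, norm_ofReal_cpow_sub_one hy0]
      exact mul_le_mul_of_nonneg_left
        (Real.rpow_le_rpow_of_nonpos ha hy.1 (by linarith)) (norm_nonneg _))
    (left_mem_Icc.2 hab) (right_mem_Icc.2 hab)
  rwa [Real.norm_of_nonneg (sub_nonneg.2 hab)] at h1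

theorem norm_integral_rpow_mul_le {x β L c : ℝ} (hx : 0 < x + β) (hc : 0 ≤ c) {g : ℝ → ℂ}
    (hg : ∀ u ∈ Ioc 0 c, ‖g u‖ ≤ L * u ^ β) {z : ℂ} (hz : z.re = x) :
    ‖∫ u in (0 : ℝ)..c, (u : ℂ) ^ (z - 1) * g u‖ ≤ L * (c ^ (x + β) / (x + β)) := by
  have h1 : ∫ u in (0 : ℝ)..c, L * u ^ (x + β - 1) = L * (c ^ (x + β) / (x + β)) := by
    rw [intervalIntegral.integral_const_mul, integral_rpow (Or.inl (by linarith)),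
      sub_add_cancel, Real.zero_rpow hx.ne', sub_zero]
  rw [← h1]
  refine intervalIntegral.norm_integral_le_of_norm_le hc (Eventually.of_forall fun u hu => ?_)
    ((intervalIntegral.intervalIntegrable_rpow' (by linarith)).const_mul _)
  rw [norm_mul, norm_ofReal_cpow_sub_one hu.1, hz]
  calc u ^ (x - 1) * ‖g u‖ ≤ u ^ (x - 1) * (L * u ^ β) :=
        mul_le_mul_of_nonneg_left (hg u hu) (Real.rpow_pos_of_pos hu.1 _).le
    _ = L * u ^ (x + β - 1) := by
        rw [show x + β - 1 = (x - 1) + β by ring, Real.rpow_add hu.1]; ring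

theorem integral_Ioc_one_eq (z : ℂ) (f : LipZero α) (t : I) {R : ℝ} (hR : 1 ≤ R) :
    ∫ u : ℝ in Ioc 0 1, (u : ℂ) ^ (z - 1) * f.extend ((t : ℝ) - u) =
      ∫ u in (0 : ℝ)..R, (u : ℂ) ^ (z - 1) * f.extend ((t : ℝ) - u) := by
  rw [intervalIntegral.integral_of_le (zero_le_one.trans hR), eq_comm]
  refine setIntegral_eq_of_subset_of_forall_sdiff_eq_zero measurableSet_Ioc
    (Ioc_subset_Ioc_right hR) fun u hu => ?_
  have hu' : 1 < u := by
    by_contra! h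
    exact hu.2 ⟨hu.1.1, h⟩
  rw [extend_of_nonpos _ (by linarith [t.2.2]), mul_zero]

theorem integral_cpow_sub_one {z : ℂ} (hz : 0 < z.re) (a b : ℝ) :
    ∫ u in a..b, (u : ℂ) ^ (z - 1) = ((b : ℂ) ^ z - (a : ℂ) ^ z) / z := by
  rw [integral_cpow (Or.inl (by simpa using hz)), sub_add_cancel]

theorem intervalIntegrable_cpow_mul (hα : 0 < α) {z : ℂ} (hz : 0 < z.re) (f : LipZero α)
    (t : ℝ) (c : ℂ) (a b : ℝ) :
    IntervalIntegrable (fun u : ℝ => (u : ℂ) ^ (z - 1) * (f.extend (t - u) - c)) volume a b :=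
  (intervalIntegrable_cpow_sub_one hz a b).mul_continuousOn
    ((((f.continuous_extend hα).comp (by fun_prop)).sub continuous_const).continuousOn)

theorem integral_cpow_mul_eq (hα : 0 < α) {z : ℂ} (hz : 0 < z.re) (f : LipZero α) (t : ℝ) (c : ℂ)
    (a b : ℝ) :
    ∫ u in a..b, (u : ℂ) ^ (z - 1) * f.extend (t - u) =
      (∫ u in a..b, (u : ℂ) ^ (z - 1) * (f.extend (t - u) - c)) +
        c * (((b : ℂ) ^ z - (a : ℂ) ^ z) / z) := by
  rw [← integral_cpow_sub_one hz, ← intervalIntegral.integral_const_mul,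
    ← intervalIntegral.integral_add (intervalIntegrable_cpow_mul hα hz f t c a b)
      ((intervalIntegrable_cpow_sub_one hz a b).const_mul c)]
  congr 1
  ext u
  ring

/-- The integral at `t` runs over `(0,R)` and the one at `s` over `(0,R - h)`, which is harmless
since the integrands vanish beyond `1`. At `t`, subtract `f t` on `(0,2h)` and `f s` beyond; at `s`,
subtract `f s` throughout. Shifting the far part at `t` by `h` aligns it with the one at `s`,
leaving a difference of kernels. The free `R` serves to remove the last term, which tends to `0` as
`R → ∞` when `Re z < 1`. -/
theorem cpowOp_sub_eq (hα : 0 < α) {z : ℂ} (hz : 0 < z.re) (f : LipZero α) {t s : I} {R h : ℝ}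
    (hh : h = (t : ℝ) - s) (hR : 2 ≤ R) :
    cpowOp hα z f t - cpowOp hα z f s =
      (∫ u in (0 : ℝ)..2 * h, (u : ℂ) ^ (z - 1) * (f.extend ((t : ℝ) - u) - f t)) -
      (∫ u in (0 : ℝ)..h, (u : ℂ) ^ (z - 1) * (f.extend ((s : ℝ) - u) - f s)) +
      (∫ u in h..(R - h), (((u + h : ℝ) : ℂ) ^ (z - 1) - (u : ℂ) ^ (z - 1)) *
        (f.extend ((s : ℝ) - u) - f s)) +
      (f t - f s) * (((2 * h : ℝ) : ℂ) ^ z / z) +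
      f s * (((R : ℂ) ^ z - ((R - h : ℝ) : ℂ) ^ z) / z) := by
  have hz0 : z ≠ 0 := by rintro rfl; simp at hz
  have hh1 : h ≤ 1 := by linarith [t.2.2, s.2.1]
  have hI := intervalIntegrable_cpow_mul hα hz f
  have e0 : ((0 : ℝ) : ℂ) ^ z = 0 := by rw [Complex.ofReal_zero, Complex.zero_cpow hz0]
  rw [cpowOp_apply hα hz, cpowOp_apply hα hz, integral_Ioc_one_eq z f t (by linarith : 1 ≤ R),
    integral_Ioc_one_eq z f s (by linarith : 1 ≤ R - h),
    ← intervalIntegral.integral_add_adjacent_intervals (b := 2 * h)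
      (by simpa using hI (t : ℝ) 0 0 (2 * h)) (by simpa using hI (t : ℝ) 0 (2 * h) R),
    integral_cpow_mul_eq hα hz f t (f t) 0 (2 * h), integral_cpow_mul_eq hα hz f t (f s) (2 * h) R,
    integral_cpow_mul_eq hα hz f s (f s) 0 (R - h),
    ← intervalIntegral.integral_add_adjacent_intervals (hI s (f s) 0 h) (hI s (f s) h (R - h)), e0]
  have e1 : ∫ u in (2 * h)..R, (u : ℂ) ^ (z - 1) * (f.extend ((t : ℝ) - u) - f s) =
      ∫ u in h..(R - h), ((u + h : ℝ) : ℂ) ^ (z - 1) * (f.extend ((s : ℝ) - u) - f s) := by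
    have := intervalIntegral.integral_comp_add_right (a := h) (b := R - h)
      (fun u : ℝ => (u : ℂ) ^ (z - 1) * (f.extend ((t : ℝ) - u) - f s)) h
    rw [sub_add_cancel, ← two_mul] at this
    rw [← this]
    congr 1
    ext u
    rw [show (t : ℝ) - (u + h) = s - u by rw [hh]; ring]
  have e2 : IntervalIntegrable (fun u : ℝ => ((u + h : ℝ) : ℂ) ^ (z - 1) *
      (f.extend ((s : ℝ) - u) - f s)) volume h (R - h) := by
    have := ((hI t (f s) (2 * h) R).comp_add_right h)
    rw [show 2 * h - h = h by ring] at this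
    refine this.congr (fun u _ => ?_)
    rw [show (t : ℝ) - (u + h) = s - u by rw [hh]; ring]
  rw [e1]
  simp_rw [sub_mul (((_ : ℝ) : ℂ) ^ (z - 1))]
  rw [intervalIntegral.integral_sub e2 (hI s (f s) h (R - h))]
  field_simp
  ring

/-- The three constants come from the near integrals, the far kernel difference and the term with
`(2h)^z / z`. The far integrand is of size `h u ^ (Re z + α - 2)`, whose integral over `(h,∞)`
converges exactly because `Re z + α < 1`. -/
theorem norm_cpowOp_apply_sub_le (hα : 0 < α) {z : ℂ} (hz : 0 < z.re) (hz1 : z.re + α < 1)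
    (f : LipZero α) {t s : I} (hst : s < t) :
    ‖cpowOp hα z f t - cpowOp hα z f s‖ ≤
      ((2 ^ (z.re + α) + 1) / (z.re + α) + ‖z - 1‖ / (1 - (z.re + α)) + 2 ^ z.re / ‖z‖) * ‖f‖ *
        ((t : ℝ) - s) ^ (z.re + α) := by
  obtain ⟨h, hh⟩ : ∃ h, h = (t : ℝ) - s := ⟨_, rfl⟩
  have hα' : (0 : ℝ) < α := hα
  have hh0 : 0 < h := by rw [hh]; exact sub_pos.2 (Subtype.coe_lt_coe.2 hst)
  have hh1 : h ≤ 1 := by linarith [t.2.2, s.2.1]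
  have hz0 : z ≠ 0 := by rintro rfl; simp at hz
  have hzn : 0 < ‖z‖ := norm_pos_iff.2 hz0
  rw [← hh]
  set x := z.re with hx
  set L := ‖f‖ with hL
  have hL0 : 0 ≤ L := norm_nonneg f
  have hF : ∀ (r : I) (u : ℝ), 0 < u → ‖f.extend ((r : ℝ) - u) - f r‖ ≤ L * u ^ (α : ℝ) := by
    intro r u hu
    have := f.norm_extend_sub_le ((r : ℝ) - u) r
    rwa [extend_coe, sub_sub_cancel_left, abs_neg, abs_of_pos hu] at this
  have hA : ‖∫ u in (0 : ℝ)..2 * h, (u : ℂ) ^ (z - 1) * (f.extend ((t : ℝ) - u) - f t)‖ ≤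
      L * ((2 * h) ^ (x + α) / (x + α)) :=
    norm_integral_rpow_mul_le (by positivity) (by positivity) (fun u hu => hF t u hu.1) rfl
  have hB : ‖∫ u in (0 : ℝ)..h, (u : ℂ) ^ (z - 1) * (f.extend ((s : ℝ) - u) - f s)‖ ≤
      L * (h ^ (x + α) / (x + α)) :=
    norm_integral_rpow_mul_le (by positivity) (by positivity) (fun u hu => hF s u hu.1) rfl
  have hC : ∀ R : ℝ, 2 ≤ R → ‖∫ u in h..(R - h), (((u + h : ℝ) : ℂ) ^ (z - 1) - (u : ℂ) ^ (z - 1)) *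
        (f.extend ((s : ℝ) - u) - f s)‖ ≤ ‖z - 1‖ * L * (h ^ (x + α) / (1 - (x + α))) := by
    intro R hR
    have hhR : h ≤ R - h := by linarith
    have h0 : (0 : ℝ) ∉ uIcc h (R - h) := by
      rw [uIcc_of_le hhR]
      exact fun h' => h'.1.not_gt hh0
    have h1 : ∫ u in h..(R - h), ‖z - 1‖ * h * L * u ^ (x + α - 2) ≤
        ‖z - 1‖ * L * (h ^ (x + α) / (1 - (x + α))) := by
      rw [intervalIntegral.integral_const_mul, integral_rpow (Or.inr ⟨by linarith, h0⟩)]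
      have h2 : 0 ≤ (R - h) ^ (x + α - 2 + 1) := Real.rpow_nonneg (by linarith) _
      have h3 : h ^ (x + α) = h * h ^ (x + α - 2 + 1) := by
        rw [← Real.rpow_one_add' hh0.le (by linarith)]
        ring_nf
      -- The exponent is negative, so the boundary term at `R - h` has the favourable sign and is
      -- dropped, uniformly in `R`.
      have h4 : ((R - h) ^ (x + α - 2 + 1) - h ^ (x + α - 2 + 1)) / (x + α - 2 + 1) ≤
          h ^ (x + α - 2 + 1) / (1 - (x + α)) := by
        rw [show x + α - 2 + 1 = -(1 - (x + α)) by ring, div_neg, ← neg_div, neg_sub]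
        rw [show x + α - 2 + 1 = -(1 - (x + α)) by ring] at h2
        gcongr
        linarith
      calc _ ≤ ‖z - 1‖ * h * L * (h ^ (x + α - 2 + 1) / (1 - (x + α))) := by gcongr
        _ = _ := by rw [h3]; ring
    refine (intervalIntegral.norm_integral_le_of_norm_le hhR (Eventually.of_forall fun u hu => ?_)
      ((intervalIntegral.intervalIntegrable_rpow (Or.inr h0)).const_mul _)).trans h1
    have hu0 : 0 < u := hh0.trans hu.1
    have h5 := norm_cpow_sub_cpow_le (w := z - 1) (by
      simp only [Complex.sub_re, Complex.one_re]; linarith) hu0 (by linarith : u ≤ u + h)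
    rw [add_sub_cancel_left, Complex.sub_re, Complex.one_re] at h5
    rw [norm_mul]
    calc _ ≤ (‖z - 1‖ * u ^ (z.re - 1 - 1) * h) * (L * u ^ (α : ℝ)) := by
          gcongr
          exact hF s u hu0
      _ = ‖z - 1‖ * h * L * u ^ (x + α - 2) := by
          rw [show x + α - 2 = (x - 1 - 1) + α by ring, Real.rpow_add hu0]; ring
  have hD : ‖(f t - f s) * (((2 * h : ℝ) : ℂ) ^ z / z)‖ ≤ L * h ^ (α : ℝ) * ((2 * h) ^ x / ‖z‖) := by
    rw [norm_mul, norm_div, Complex.norm_cpow_eq_rpow_re_of_pos (by positivity)]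
    gcongr
    have := f.norm_apply_sub_le t s
    rwa [← hh, abs_of_pos hh0] at this
  have hE : ∀ R : ℝ, 2 ≤ R → ‖f s * (((R : ℂ) ^ z - ((R - h : ℝ) : ℂ) ^ z) / z)‖ ≤
      L * h * (R - h) ^ (x - 1) := by
    intro R hR
    have h5 := norm_cpow_sub_cpow_le (w := z) (by linarith) (by linarith : 0 < R - h)
      (by linarith : R - h ≤ R)
    rw [sub_sub_cancel] at h5
    rw [norm_mul, norm_div]
    have h6 := f.norm_apply_le s
    calc _ ≤ L * (‖z‖ * (R - h) ^ (z.re - 1) * h / ‖z‖) := by gcongr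
      _ = _ := by field_simp; rw [hx]
  -- Only the last error depends on `R`; it decays like `R ^ (Re z - 1)`.
  have hlim : Tendsto (fun R : ℝ => (((2 ^ (x + α) + 1) / (x + α) + ‖z - 1‖ / (1 - (x + α)) +
      2 ^ x / ‖z‖) * L * h ^ (x + α)) + L * h * (R - h) ^ (x - 1)) atTop
      (𝓝 ((((2 ^ (x + α) + 1) / (x + α) + ‖z - 1‖ / (1 - (x + α)) +
      2 ^ x / ‖z‖) * L * h ^ (x + α)) + L * h * 0)) := by
    refine tendsto_const_nhds.add (tendsto_const_nhds.mul ?_)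
    have h7 := (tendsto_rpow_neg_atTop (y := 1 - x) (by linarith)).comp
      (tendsto_atTop_add_const_right atTop (-h) tendsto_id)
    refine h7.congr fun R => ?_
    simp [sub_eq_add_neg, add_comm]
  rw [mul_zero, add_zero] at hlim
  refine ge_of_tendsto hlim ?_
  filter_upwards [eventually_ge_atTop 2] with R hR
  rw [cpowOp_sub_eq hα hz f hh hR]
  refine (norm_add_le _ _).trans (add_le_add ?_ (hE R hR))
  refine ((norm_add_le _ _).trans (add_le_add ((norm_add_le _ _).trans (add_le_add
    ((norm_sub_le _ _).trans (add_le_add hA hB)) (hC R hR))) hD)).trans (le_of_eq ?_)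
  rw [Real.mul_rpow two_pos.le hh0.le, Real.mul_rpow two_pos.le hh0.le, Real.rpow_add hh0]
  field_simp

/-- The smallness of `z` gives `1 - (Re z + α) ≥ (1 - α) / 2`, and `Γ(z + 1) = z Γ(z)` turns the
singular factor `1 / |z|` into `1 / |Γ(z + 1)|`. The exponent `α + Re z` is kept because its gain
over `α` puts the image in `lip_0^α`. -/
theorem norm_fracInt_apply_sub_le (hα : 0 < α) {z : ℂ} (hz : 0 < z.re)
    (hz1 : ‖z‖ ≤ (1 - (α : ℝ)) / 2) (hα1 : α < 1) (f : LipZero α) {t s : I} (hst : s < t) :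
    ‖fracInt hα z f t - fracInt hα z f s‖ ≤
      (‖Complex.Gamma z‖⁻¹ * (5 / (α : ℝ) + 2 * ‖z - 1‖ / (1 - (α : ℝ))) +
          (1 + (2 : ℝ) ^ (1 + (α : ℝ))) * ‖Complex.Gamma (z + 1)‖⁻¹) * ‖f‖ *
        ((t : ℝ) - s) ^ (α + z.re : ℝ) := by
  have hα' : (0 : ℝ) < α := hα
  have hα1' : (α : ℝ) < 1 := hα1
  have hz0 : z ≠ 0 := by rintro rfl; simp at hz
  have hzn : 0 < ‖z‖ := norm_pos_iff.2 hz0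
  have hx : z.re ≤ (1 - (α : ℝ)) / 2 := (Complex.re_le_norm z).trans hz1
  have h1 := norm_cpowOp_apply_sub_le hα hz (by linarith) f hst
  have h2 : fracInt hα z f t - fracInt hα z f s =
      (Complex.Gamma z)⁻¹ * (cpowOp hα z f t - cpowOp hα z f s) := by
    rw [mul_sub]; rfl
  have hΓ : 0 < ‖Complex.Gamma z‖ := norm_pos_iff.2 (Complex.Gamma_ne_zero_of_re_pos hz)
  have h3 : (2 : ℝ) ^ (z.re + α) ≤ 2 := by
    calc (2 : ℝ) ^ (z.re + α) ≤ 2 ^ (1 : ℝ) := by gcongr <;> linarith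
      _ = 2 := Real.rpow_one 2
  have h4 : (2 : ℝ) ^ z.re ≤ 1 + (2 : ℝ) ^ (1 + (α : ℝ)) := by
    have : (2 : ℝ) ^ z.re ≤ (2 : ℝ) ^ (1 + (α : ℝ)) := by gcongr <;> linarith
    linarith
  have h5 : ((2 : ℝ) ^ (z.re + α) + 1) / (z.re + α) ≤ 5 / α := by
    gcongr
    · linarith
    · linarith
  have h6 : ‖z - 1‖ / (1 - (z.re + α)) ≤ 2 * ‖z - 1‖ / (1 - (α : ℝ)) := by
    rw [div_le_div_iff₀ (by linarith) (by linarith)]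
    nlinarith [norm_nonneg (z - 1)]
  have hts : 0 < (t : ℝ) - s := sub_pos.2 (Subtype.coe_lt_coe.2 hst)
  rw [h2, norm_mul, norm_inv, Complex.Gamma_add_one z hz0, norm_mul, add_comm (α : ℝ) z.re]
  calc _ ≤ ‖Complex.Gamma z‖⁻¹ * ((5 / α + 2 * ‖z - 1‖ / (1 - (α : ℝ)) +
        (1 + (2 : ℝ) ^ (1 + (α : ℝ))) / ‖z‖) * ‖f‖ * ((t : ℝ) - s) ^ (z.re + α)) := by
        gcongr
        refine h1.trans ?_
        gcongr
    _ = _ := by field_simp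

theorem norm_fracInt_le_of_norm_le (hα : 0 < α) (hα1 : α < 1) {z : ℂ} (hz : 0 < z.re)
    (hz1 : ‖z‖ ≤ (1 - (α : ℝ)) / 2) :
    ‖fracInt hα z‖ ≤ ‖Complex.Gamma z‖⁻¹ * (5 / (α : ℝ) + 2 * ‖z - 1‖ / (1 - (α : ℝ))) +
          (1 + (2 : ℝ) ^ (1 + (α : ℝ))) * ‖Complex.Gamma (z + 1)‖⁻¹ := by
  have hα1' : (α : ℝ) < 1 := hα1
  have h0 : 0 < 1 - (α : ℝ) := by linarith
  refine ContinuousLinearMap.opNorm_le_bound _ (by positivity) fun f =>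
    norm_le_of_bound_of_lt _ (by positivity) fun t s hst => ?_
  have hts : 0 < (t : ℝ) - s := sub_pos.2 (Subtype.coe_lt_coe.2 hst)
  refine (norm_fracInt_apply_sub_le hα hz hz1 hα1 f hst).trans ?_
  refine mul_le_mul_of_nonneg_left ?_ (by positivity)
  exact Real.rpow_le_rpow_of_exponent_ge hts (by linarith [t.2.2, s.2.1]) (by linarith)

end LipZero

/-! ### Sectors in the right half-plane -/

theorem mem_openSector_pi_div_two {z : ℂ} : z ∈ openSector (Real.pi / 2) ↔ 0 < z.re := by
  rw [openSector, mem_ofPred_eq, Complex.abs_arg_lt_pi_div_two_iff]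
  constructor
  · rintro ⟨h0, h | h⟩
    · exact h
    · exact absurd h h0
  · intro h
    exact ⟨by rintro rfl; simp at h, Or.inl h⟩

theorem re_pos_of_mem_openSector {θ : ℝ} (hθ : θ < Real.pi / 2) {z : ℂ} (hz : z ∈ openSector θ) :
    0 < z.re :=
  mem_openSector_pi_div_two.1 ⟨hz.1, hz.2.trans hθ⟩

theorem norm_mul_cos_le_re {θ : ℝ} (hθ : θ < Real.pi / 2) {z : ℂ} (hz : z ∈ openSector θ) :
    ‖z‖ * Real.cos θ ≤ z.re := by
  conv_rhs => rw [← Complex.norm_mul_cos_arg z]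
  rw [← Real.cos_abs z.arg]
  refine mul_le_mul_of_nonneg_left ?_ (norm_nonneg _)
  exact Real.cos_le_cos_of_nonneg_of_le_pi (abs_nonneg _) (by linarith [Real.pi_pos]) hz.2.le

namespace LipZero

variable {α : ℝ≥0}

/-! ### Bounds on half discs and sectors -/

/-- The explicit bound is continuous in `z` even at `0`, since `1 / Γ` is entire, hence bounded on
the closed disc. Taking `C ≥ 1` makes `log C` nonnegative later. -/
theorem exists_norm_fracInt_le_of_norm_le (hα : 0 < α) (hα1 : α < 1) :
    ∃ C, 1 ≤ C ∧ ∀ z : ℂ, 0 < z.re → ‖z‖ ≤ (1 - (α : ℝ)) / 2 → ‖fracInt hα z‖ ≤ C := by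
  have hα1' : (α : ℝ) < 1 := hα1
  have hc : Continuous fun z : ℂ =>
      ‖(Complex.Gamma z)⁻¹‖ * (5 / (α : ℝ) + 2 * ‖z - 1‖ / (1 - (α : ℝ))) +
        (1 + (2 : ℝ) ^ (1 + (α : ℝ))) * ‖(Complex.Gamma (z + 1))⁻¹‖ := by
    have h1 := Complex.differentiable_one_div_Gamma.continuous
    have h2 : Continuous fun z : ℂ => (Complex.Gamma (z + 1))⁻¹ := h1.comp (by fun_prop)
    fun_prop
  obtain ⟨C, hC⟩ := (isCompact_closedBall (0 : ℂ) ((1 - (α : ℝ)) / 2)).bddAbove_image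
    hc.continuousOn
  refine ⟨max C 1, le_max_right _ _, fun z hz hz1 => ?_⟩
  refine (norm_fracInt_le_of_norm_le hα hα1 hz hz1).trans (le_trans ?_ (le_max_left _ _))
  rw [← norm_inv, ← norm_inv]
  exact hC ⟨z, by simpa using hz1, rfl⟩

theorem fracInt_nat_mul (hα : 0 < α) {z : ℂ} (hz : 0 < z.re) (n : ℕ) :
    fracInt hα ((n + 1 : ℕ) * z) = fracInt hα z ^ (n + 1) := by
  induction n with
  | zero => simp
  | succ n ih =>
    have h1 : 0 < (((n + 1 : ℕ) : ℂ) * z).re := by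
      rw [← nsmul_eq_mul, Complex.re_nsmul]
      positivity
    rw [pow_succ, ← ih, Nat.cast_succ (n + 1), add_mul, one_mul, fracInt_add hα h1 hz]
    rfl

theorem exists_norm_fracInt_le_exp (hα : 0 < α) (hα1 : α < 1) :
    ∃ C ω : ℝ, 0 ≤ C ∧ 0 ≤ ω ∧ ∀ z : ℂ, 0 < z.re → ‖fracInt hα z‖ ≤ C * Real.exp (ω * ‖z‖) := by
  have hα1' : (α : ℝ) < 1 := hα1
  obtain ⟨C, hC1, hC⟩ := exists_norm_fracInt_le_of_norm_le hα hα1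
  set ρ := (1 - (α : ℝ)) / 2 with hρ
  have hρ0 : 0 < ρ := by rw [hρ]; linarith
  have hC0 : 0 < C := by linarith
  have hlog : 0 ≤ Real.log C := Real.log_nonneg hC1
  refine ⟨C, Real.log C / ρ, by linarith, by positivity, fun z hz => ?_⟩
  -- Cut `z` into `n + 1` equal pieces of modulus at most `ρ`; then `C ^ (n + 1) = C exp(n log C)`
  -- with `n ≤ |z| / ρ`.
  set n := ⌊‖z‖ / ρ⌋₊ with hn
  have hn1 : ‖z‖ / ρ < n + 1 := Nat.lt_floor_add_one _
  have hn2 : (n : ℝ) ≤ ‖z‖ / ρ := Nat.floor_le (by positivity)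
  have hn0 : ((n + 1 : ℕ) : ℂ) ≠ 0 := Nat.cast_ne_zero.2 n.succ_ne_zero
  have hzn : z = (n + 1 : ℕ) * (z / (n + 1 : ℕ)) := by field_simp
  have h1 : 0 < (z / (n + 1 : ℕ)).re := by
    rw [Complex.div_natCast_re]
    positivity
  have h2 : ‖z / (n + 1 : ℕ)‖ ≤ ρ := by
    rw [norm_div, Complex.norm_natCast, div_le_iff₀ (by positivity), mul_comm]
    rw [div_lt_iff₀ hρ0] at hn1
    push_cast
    exact hn1.le
  calc ‖fracInt hα z‖ = ‖fracInt hα (z / (n + 1 : ℕ)) ^ (n + 1)‖ := by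
        rw [← fracInt_nat_mul hα h1, ← hzn]
    _ ≤ ‖fracInt hα (z / (n + 1 : ℕ))‖ ^ (n + 1) := norm_pow_le' _ n.succ_pos
    _ ≤ C ^ (n + 1) := by gcongr; exact hC _ h1 h2
    _ = C * Real.exp (Real.log C * n) := by
        rw [pow_succ, mul_comm, mul_comm (Real.log C), Real.exp_nat_mul, Real.exp_log hC0]
    _ ≤ C * Real.exp (Real.log C / ρ * ‖z‖) := by
        gcongr C * Real.exp ?_
        calc Real.log C * n ≤ Real.log C * (‖z‖ / ρ) := by gcongr
          _ = _ := by ring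

theorem exists_norm_fracInt_le_of_norm_le_radius (hα : 0 < α) (hα1 : α < 1) (R : ℝ) :
    ∃ C, ∀ z : ℂ, 0 < z.re → ‖z‖ ≤ R → ‖fracInt hα z‖ ≤ C := by
  obtain ⟨C, ω, hC, hω, h⟩ := exists_norm_fracInt_le_exp hα hα1
  refine ⟨C * Real.exp (ω * R), fun z hz hzR => (h z hz).trans ?_⟩
  gcongr

theorem isHolomorphicSemigroup_fracInt (hα : 0 < α) (hα1 : α < 1) :
    IsHolomorphicSemigroup (Real.pi / 2) (fracInt hα) where
  map_add z hz w hw :=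
    fracInt_add hα (mem_openSector_pi_div_two.1 hz) (mem_openSector_pi_div_two.1 hw)
  differentiableOn z hz :=
    (differentiableAt_fracInt hα (mem_openSector_pi_div_two.1 hz)).differentiableWithinAt
  bound θ h0 hθ := by
    obtain ⟨C, ω, hC, hω, h⟩ := exists_norm_fracInt_le_exp hα hα1
    have hcos : 0 < Real.cos θ := Real.cos_pos_of_mem_Ioo ⟨by linarith [Real.pi_pos], hθ⟩
    refine ⟨C, ω / Real.cos θ, by positivity, fun z hz => ?_⟩
    refine (h z (re_pos_of_mem_openSector hθ hz)).trans ?_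
    gcongr C * Real.exp ?_
    rw [div_mul_eq_mul_div, le_div_iff₀ hcos, mul_assoc]
    gcongr
    exact norm_mul_cos_le_re hθ hz

/-! ### Fractional integration and the little Hölder space -/

theorem fracInt_mem_littleLipZero (hα : 0 < α) (hα1 : α < 1) {z : ℂ} (hz : 0 < z.re)
    (f : LipZero α) : fracInt hα z f ∈ littleLipZero α := by
  have hα1' : (α : ℝ) < 1 := hα1
  have small : ∀ w : ℂ, 0 < w.re → ‖w‖ ≤ (1 - (α : ℝ)) / 2 → ∀ g : LipZero α,
      fracInt hα w g ∈ littleLipZero α := fun w hw hw1 g =>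
    mem_littleLipZero_of_rpow_bound hw fun t s hst =>
      norm_fracInt_apply_sub_le hα hw hw1 hα1 g hst
  obtain ⟨n, hn⟩ := exists_nat_gt (‖z‖ / ((1 - (α : ℝ)) / 2))
  have hρ0 : 0 < (1 - (α : ℝ)) / 2 := by linarith
  have hn0 : ((n + 2 : ℕ) : ℂ) ≠ 0 := Nat.cast_ne_zero.2 (by omega)
  have h1 : 0 < (z / (n + 2 : ℕ)).re := by
    rw [Complex.div_natCast_re]
    positivity
  have h2 : ‖z / (n + 2 : ℕ)‖ ≤ (1 - (α : ℝ)) / 2 := by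
    rw [norm_div, Complex.norm_natCast, div_le_iff₀ (by positivity), mul_comm]
    rw [div_lt_iff₀ hρ0] at hn
    push_cast
    linarith
  -- Split off one small piece, whose operator already has range in `lip_0^α`. With `n + 2` pieces
  -- the other summand is never `0`, so the semigroup law applies.
  have h3 : z = z / (n + 2 : ℕ) + (n + 1 : ℕ) * (z / (n + 2 : ℕ)) := by
    field_simp
    push_cast
    ring
  have h4 : 0 < (((n + 1 : ℕ) : ℂ) * (z / (n + 2 : ℕ))).re := by
    rw [← nsmul_eq_mul, Complex.re_nsmul]
    positivity
  rw [h3, fracInt_add hα h1 h4]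
  exact small _ h1 h2 _

theorem integral_rpow_Ioc {x : ℝ} (hx : 0 < x) : ∫ u in Ioc (0 : ℝ) 1, u ^ (x - 1) = 1 / x := by
  rw [← intervalIntegral.integral_of_le zero_le_one, integral_rpow (Or.inl (by linarith)),
    sub_add_cancel, Real.zero_rpow hx.ne', Real.one_rpow, sub_zero]

/-- The kernel has total mass `1 / Γ(r + 1)`, so the difference is an integral of the translation
errors `f(· - u) - f`. As `r → 0` the mass concentrates at `u = 0`, where these errors are at most
`ε`. -/
theorem norm_fracInt_sub_le (hα : 0 < α) {r : ℝ} (hr : 0 < r) (f : LipZero α) {ε δ : ℝ}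
    (hε : 0 ≤ ε) (hδ : 0 < δ)
    (h : ∀ u, 0 < u → u ≤ δ → ∀ t s : ℝ,
      ‖(f.extend (t - u) - f.extend t) - (f.extend (s - u) - f.extend s)‖ ≤
        ε * |t - s| ^ (α : ℝ)) :
    ‖fracInt hα r f - ((Real.Gamma (r + 1))⁻¹ : ℝ) • f‖ ≤
      (Real.Gamma (r + 1))⁻¹ * (ε + r * (2 * ‖f‖ / δ)) := by
  have hrc : 0 < (r : ℂ).re := hr
  have hr0 : (r : ℂ) ≠ 0 := Complex.ofReal_ne_zero.2 hr.ne'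
  have hΓ : 0 < Real.Gamma (r + 1) := Real.Gamma_pos_of_pos (by linarith)
  have hΓ' : 0 < Real.Gamma r := Real.Gamma_pos_of_pos hr
  have hk := integrableOn_cpow_sub_one hrc
  have hval : ∀ t : I, (fracInt hα r f - ((Real.Gamma (r + 1))⁻¹ : ℝ) • f) t =
      (Complex.Gamma r)⁻¹ *
        ∫ u : ℝ in Ioc 0 1, (u : ℂ) ^ ((r : ℂ) - 1) * (f.extend ((t : ℝ) - u) - f.extend t) := by
    intro t
    have h1 : (fracInt hα r f - ((Real.Gamma (r + 1))⁻¹ : ℝ) • f) t =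
        fracInt hα r f t - (((Real.Gamma (r + 1))⁻¹ : ℝ) : ℂ) * f t := rfl
    have h2 : ∫ u : ℝ in Ioc 0 1, (u : ℂ) ^ ((r : ℂ) - 1) = 1 / (r : ℂ) := by
      rw [← intervalIntegral.integral_of_le zero_le_one, integral_cpow_sub_one hrc]
      simp [Complex.zero_cpow hr0]
    rw [h1, fracInt_apply hα hrc]
    simp_rw [mul_sub]
    rw [integral_sub (integrableOn_mul_extend hα hk f (by fun_prop)) (hk.mul_const _),
      integral_mul_const, h2, extend_coe, mul_sub, Complex.ofReal_inv, ← Complex.Gamma_ofReal,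
      Complex.ofReal_add, Complex.ofReal_one, Complex.Gamma_add_one _ hr0]
    field_simp
  -- For `u > δ` the trivial bound `2‖f‖` is at most `2‖f‖ u / δ`. The extra factor `u` removes the
  -- singularity of the kernel, so this part costs only `O(r)`.
  have hΔ : ∀ t s u : ℝ, 0 < u →
      ‖(f.extend (t - u) - f.extend t) - (f.extend (s - u) - f.extend s)‖ ≤
        (ε + 2 * ‖f‖ / δ * u) * |t - s| ^ (α : ℝ) := by
    intro t s u hu
    rcases le_or_gt u δ with huδ | huδ
    · refine (h u hu huδ t s).trans ?_
      gcongr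
      have : 0 ≤ 2 * ‖f‖ / δ * u := by positivity
      linarith
    · have h1 := f.norm_extend_sub_le (t - u) (s - u)
      have h2 := f.norm_extend_sub_le t s
      rw [sub_sub_sub_cancel_right] at h1
      have h3 : (f.extend (t - u) - f.extend t) - (f.extend (s - u) - f.extend s) =
          (f.extend (t - u) - f.extend (s - u)) - (f.extend t - f.extend s) := by ring
      rw [h3]
      calc _ ≤ ‖f‖ * |t - s| ^ (α : ℝ) + ‖f‖ * |t - s| ^ (α : ℝ) :=
            (norm_sub_le _ _).trans (add_le_add h1 h2)
        _ = (2 * ‖f‖) * |t - s| ^ (α : ℝ) := by ring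
        _ ≤ _ := by
          gcongr
          have h4 : 2 * ‖f‖ ≤ 2 * ‖f‖ / δ * u := by
            rw [div_mul_eq_mul_div, le_div_iff₀ hδ]
            gcongr
          linarith
  refine norm_le_of_bound _ (by positivity) fun t s => ?_
  rw [hval, hval, ← mul_sub, ← integral_sub
    (by simp only [mul_sub]; exact
      (integrableOn_mul_extend hα hk f (by fun_prop)).sub (hk.mul_const _))
    (by simp only [mul_sub]; exact
      (integrableOn_mul_extend hα hk f (by fun_prop)).sub (hk.mul_const _)), norm_mul, norm_inv,
    Complex.Gamma_ofReal, Complex.norm_real, Real.norm_of_nonneg hΓ'.le, Real.Gamma_add_one hr.ne']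
  have hint : Integrable (fun u : ℝ => (ε * u ^ (r - 1) + 2 * ‖f‖ / δ * u ^ (r + 1 - 1)) *
      |(t : ℝ) - s| ^ (α : ℝ)) (volume.restrict (Ioc 0 1)) :=
    (((integrableOn_rpow_sub_one hr).const_mul ε).add
      ((integrableOn_rpow_sub_one (by linarith : 0 < r + 1)).const_mul _)).mul_const _
  have hbound := norm_integral_le_of_norm_le (f := fun u : ℝ =>
      (u : ℂ) ^ ((r : ℂ) - 1) * (f.extend ((t : ℝ) - u) - f.extend t) -
        (u : ℂ) ^ ((r : ℂ) - 1) * (f.extend ((s : ℝ) - u) - f.extend s)) hint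
    ((ae_restrict_iff' measurableSet_Ioc).2 (Eventually.of_forall fun u hu => by
      rw [← mul_sub, norm_mul, norm_ofReal_cpow_sub_one hu.1, Complex.ofReal_re,
        add_sub_cancel_right]
      have h5 : u ^ r = u ^ (r - 1) * u := by
        rw [Real.rpow_sub_one hu.1.ne', div_mul_cancel₀ _ hu.1.ne']
      have h6 : 0 ≤ u ^ (r - 1) := Real.rpow_nonneg hu.1.le _
      calc _ ≤ u ^ (r - 1) * ((ε + 2 * ‖f‖ / δ * u) * |(t : ℝ) - s| ^ (α : ℝ)) := by
            gcongr
            exact hΔ t s u hu.1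
        _ = _ := by rw [h5]; ring))
  rw [integral_mul_const, integral_add ((integrableOn_rpow_sub_one hr).const_mul ε)
    ((integrableOn_rpow_sub_one (by linarith : 0 < r + 1)).const_mul _), integral_const_mul,
    integral_const_mul, integral_rpow_Ioc hr, integral_rpow_Ioc (by linarith)] at hbound
  calc _ ≤ (Real.Gamma r)⁻¹ * ((ε * (1 / r) + 2 * ‖f‖ / δ * (1 / (r + 1))) *
        |(t : ℝ) - s| ^ (α : ℝ)) := by gcongr
    _ ≤ (Real.Gamma r)⁻¹ * ((ε * (1 / r) + 2 * ‖f‖ / δ * 1) * |(t : ℝ) - s| ^ (α : ℝ)) := by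
        gcongr
        rw [div_le_one (by linarith)]
        linarith
    _ = _ := by field_simp

/-- The second difference can be grouped in two ways. If `t` and `s` are close, compare them before
and after translation; otherwise `u ≤ |t - s|`, and each point is compared with its own translate.
-/
theorem exists_norm_translate_sub_le {f : LipZero α} (hα : 0 < α) (hf : f ∈ littleLipZero α)
    {ε : ℝ} (hε : 0 < ε) :
    ∃ δ > 0, ∀ u, 0 < u → u ≤ δ → ∀ t s : ℝ,
      ‖(f.extend (t - u) - f.extend t) - (f.extend (s - u) - f.extend s)‖ ≤
        ε * |t - s| ^ (α : ℝ) := by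
  have hα' : (0 : ℝ) < α := hα
  obtain ⟨η, hη, h⟩ := exists_norm_extend_sub_le hf (half_pos hε)
  refine ⟨η, hη, fun u hu huη t s => ?_⟩
  rcases le_total |t - s| η with hts | hts
  · have h1 := h (t - u) (s - u) (by rwa [sub_sub_sub_cancel_right])
    have h2 := h t s hts
    rw [sub_sub_sub_cancel_right] at h1
    have h3 : (f.extend (t - u) - f.extend t) - (f.extend (s - u) - f.extend s) =
        (f.extend (t - u) - f.extend (s - u)) - (f.extend t - f.extend s) := by ring
    rw [h3]
    refine (norm_sub_le _ _).trans ((add_le_add h1 h2).trans (le_of_eq (by ring)))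
  · have hu' : ∀ r : ℝ, ‖f.extend (r - u) - f.extend r‖ ≤ ε / 2 * |t - s| ^ (α : ℝ) := by
      intro r
      have h1 : |r - u - r| = u := by rw [sub_sub_cancel_left, abs_neg, abs_of_pos hu]
      have h2 := h (r - u) r (by rw [h1]; exact huη)
      rw [h1] at h2
      refine h2.trans ?_
      gcongr
      exact huη.trans hts
    refine (norm_sub_le _ _).trans ((add_le_add (hu' t) (hu' s)).trans (le_of_eq (by ring)))

theorem tendsto_fracInt_of_mem_littleLipZero (hα : 0 < α) {f : LipZero α}
    (hf : f ∈ littleLipZero α) : Tendsto (fun r : ℝ => fracInt hα r f) (𝓝[>] 0) (𝓝 f) := by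
  have hΓ : Tendsto (fun r : ℝ => (Real.Gamma (r + 1))⁻¹) (𝓝[>] 0) (𝓝 1) := by
    have h1 : ContinuousAt (fun r : ℝ => (Real.Gamma (r + 1))⁻¹) 0 := by
      have h2 : ContinuousAt Real.Gamma (0 + 1) := by
        refine (Real.differentiableAt_Gamma fun m => ?_).continuousAt
        have : (0 : ℝ) ≤ m := m.cast_nonneg
        linarith
      refine ContinuousAt.inv₀ (ContinuousAt.comp (f := fun r : ℝ => r + 1) h2 (by fun_prop)) ?_
      simp
    have h3 := h1.tendsto
    simp only [zero_add, Real.Gamma_one, inv_one] at h3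
    exact h3.mono_left nhdsWithin_le_nhds
  have hsmul : Tendsto (fun r : ℝ => ((Real.Gamma (r + 1))⁻¹ : ℝ) • f) (𝓝[>] 0) (𝓝 f) := by
    simpa using hΓ.smul_const f
  have hdiff : Tendsto (fun r : ℝ => fracInt hα r f - ((Real.Gamma (r + 1))⁻¹ : ℝ) • f)
      (𝓝[>] 0) (𝓝 0) := by
    rw [Metric.tendsto_nhds]
    intro ε hε
    obtain ⟨δ, hδ, h⟩ := exists_norm_translate_sub_le hα hf (half_pos hε)
    have hid : Tendsto (fun r : ℝ => r) (𝓝[>] 0) (𝓝 0) := nhdsWithin_le_nhds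
    have hlim := hΓ.mul (tendsto_const_nhds (x := ε / 2) |>.add
      (hid.mul_const (2 * ‖f‖ / δ)))
    have hlt := hlim.eventually_lt_const (u := ε) (by linarith)
    filter_upwards [hlt, self_mem_nhdsWithin] with r hr hr0
    rw [dist_zero_right]
    exact (norm_fracInt_sub_le hα hr0 f (half_pos hε).le hδ h).trans_lt hr
  simpa using hdiff.add hsmul

theorem tendsto_fracInt_iff (hα : 0 < α) (hα1 : α < 1) (f : LipZero α) :
    Tendsto (fun r : ℝ => fracInt hα r f) (𝓝[>] 0) (𝓝 f) ↔ f ∈ littleLipZero α := by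
  refine ⟨fun h => ?_, tendsto_fracInt_of_mem_littleLipZero hα⟩
  refine isClosed_littleLipZero.mem_of_tendsto h ?_
  filter_upwards [self_mem_nhdsWithin] with r hr
  exact fracInt_mem_littleLipZero hα hα1 (by simpa using hr) f

end LipZero

/-! ### Boundary groups -/

/-- A holomorphic semigroup on the right half-plane that is bounded on half discs and strongly
continuous at `0` along the positive real axis. -/
structure IsHalfPlaneSemigroup {E : Type*} [NormedAddCommGroup E] [NormedSpace ℂ E]
    (T : ℂ → E →L[ℂ] E) : Prop where
  map_add : ∀ z w : ℂ, 0 < z.re → 0 < w.re → T (z + w) = (T z).comp (T w)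
  differentiableAt : ∀ z : ℂ, 0 < z.re → DifferentiableAt ℂ T z
  bound : ∀ R : ℝ, ∃ C, ∀ z : ℂ, 0 < z.re → ‖z‖ ≤ R → ‖T z‖ ≤ C
  tendsto : ∀ x, Tendsto (fun r : ℝ => T r x) (𝓝[>] 0) (𝓝 x)

namespace IsHalfPlaneSemigroup

variable {E : Type*} [NormedAddCommGroup E] [NormedSpace ℂ E] {T : ℂ → E →L[ℂ] E}

theorem exists_bound (hT : IsHalfPlaneSemigroup T) (R : ℝ) :
    ∃ C, 0 < C ∧ ∀ z : ℂ, 0 < z.re → ‖z‖ ≤ R → ‖T z‖ ≤ C := by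
  obtain ⟨C, hC⟩ := hT.bound R
  exact ⟨max C 1, by positivity, fun z hz hzR => (hC z hz hzR).trans (le_max_left _ _)⟩

/-- Orbits are uniformly continuous on half discs. -/
theorem exists_norm_sub_lt (hT : IsHalfPlaneSemigroup T) (x : E) (R : ℝ) {ε : ℝ} (hε : 0 < ε) :
    ∃ δ > 0, ∀ z w : ℂ, 0 < z.re → 0 < w.re → ‖z‖ ≤ R → ‖w‖ ≤ R → ‖z - w‖ < δ →
      ‖T z x - T w x‖ < ε := by
  obtain ⟨C, hC0, hC⟩ := hT.exists_bound R
  have h1 : ∀ᶠ r : ℝ in 𝓝[>] 0, ‖T r x - x‖ < ε / (4 * C) :=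
    (tendsto_iff_norm_sub_tendsto_zero.1 (hT.tendsto x)).eventually_lt_const (by positivity)
  obtain ⟨r, hr, hr0⟩ := (h1.and self_mem_nhdsWithin).exists
  have hr0' : 0 < r := hr0
  -- The orbit of `T r x` at `z` is that of `x` at `z + r`, which stays in this compact subset of
  -- the open half-plane. Replacing `x` by `T r x` costs `ε / 4` at each point by the uniform bound
  -- `C`.
  set K := Metric.closedBall (0 : ℂ) (R + r) ∩ {z : ℂ | r ≤ z.re} with hK
  have hKc : IsCompact K := (isCompact_closedBall _ _).inter_right
    (isClosed_le continuous_const Complex.continuous_re)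
  have hcont : ContinuousOn (fun z => T z x) K := fun z hz =>
    ((hT.differentiableAt z (hr0'.trans_le hz.2)).continuousAt.clm_apply
      continuousAt_const).continuousWithinAt
  obtain ⟨δ, hδ, hδ'⟩ := Metric.uniformContinuousOn_iff.1
    (hKc.uniformContinuousOn_of_continuous hcont) (ε / 2) (half_pos hε)
  refine ⟨δ, hδ, fun z w hz hw hzR hwR hzw => ?_⟩
  have hmem : ∀ v : ℂ, 0 < v.re → ‖v‖ ≤ R → v + r ∈ K := by
    intro v hv hvR
    refine ⟨?_, ?_⟩
    · rw [mem_closedBall_zero_iff]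
      refine (norm_add_le _ _).trans ?_
      rw [Complex.norm_real, Real.norm_of_nonneg hr0'.le]
      linarith
    · simp [hv.le]
  have h2 := hδ' (z + r) (hmem z hz hzR) (w + r) (hmem w hw hwR) (by
    rwa [dist_eq_norm, add_sub_add_right_eq_sub])
  rw [dist_eq_norm, hT.map_add z r hz (by simpa using hr0'),
    hT.map_add w r hw (by simpa using hr0'), ContinuousLinearMap.comp_apply,
    ContinuousLinearMap.comp_apply] at h2
  have h3 : ∀ v : ℂ, 0 < v.re → ‖v‖ ≤ R → ‖T v (T r x) - T v x‖ < ε / 4 := by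
    intro v hv hvR
    rw [← map_sub]
    calc ‖T v (T r x - x)‖ ≤ C * ‖T r x - x‖ := (T v).le_of_opNorm_le (hC v hv hvR) _
      _ < C * (ε / (4 * C)) := by gcongr
      _ = ε / 4 := by field_simp
  have h4 : T z x - T w x =
      (T z (T r x) - T w (T r x)) - (T z (T r x) - T z x) + (T w (T r x) - T w x) := by abel
  rw [h4]
  calc _ ≤ ‖T z (T r x) - T w (T r x)‖ + ‖T z (T r x) - T z x‖ + ‖T w (T r x) - T w x‖ :=
        (norm_add_le _ _).trans (add_le_add_left (norm_sub_le _ _) _)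
    _ < ε / 2 + ε / 4 + ε / 4 := add_lt_add (add_lt_add h2 (h3 z hz hzR)) (h3 w hw hwR)
    _ = ε := by ring

theorem tendsto_halfPlane (hT : IsHalfPlaneSemigroup T) (x : E) :
    Tendsto (fun z => T z x) (𝓝[{z : ℂ | 0 < z.re}] 0) (𝓝 x) := by
  rw [Metric.tendsto_nhdsWithin_nhds]
  intro ε hε
  obtain ⟨δ, hδ, h⟩ := hT.exists_norm_sub_lt x 1 (half_pos hε)
  refine ⟨min δ 1, by positivity, fun z hz hzd => ?_⟩
  rw [dist_zero_right] at hzd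
  have hz1 : ‖z‖ < δ := hzd.trans_le (min_le_left _ _)
  have hz2 : ‖z‖ < 1 := hzd.trans_le (min_le_right _ _)
  rw [dist_eq_norm]
  refine lt_of_le_of_lt ?_ (half_lt_self hε)
  refine le_of_tendsto ((tendsto_const_nhds.sub (hT.tendsto x)).norm) ?_
  have h1 : Tendsto (fun r : ℝ => ‖z - (r : ℂ)‖) (𝓝[>] 0) (𝓝 ‖z‖) := by
    have : Continuous fun r : ℝ => ‖z - (r : ℂ)‖ := by fun_prop
    have h2 := this.tendsto 0
    simp only [Complex.ofReal_zero, sub_zero] at h2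
    exact h2.mono_left nhdsWithin_le_nhds
  have h3 : ∀ᶠ r : ℝ in 𝓝[>] 0, r < 1 :=
    nhdsWithin_le_nhds (eventually_lt_nhds one_pos)
  filter_upwards [self_mem_nhdsWithin, h1.eventually_lt_const hz1, h3] with r hr0 hr1 hr2
  have hr0' : 0 < r := hr0
  refine (h z r hz (by simpa using hr0') hz2.le ?_ hr1).le
  rw [Complex.norm_real, Real.norm_of_nonneg hr0'.le]
  exact hr2.le

theorem norm_add_mul_I_le {e t R : ℝ} (he0 : 0 < e) (he1 : e ≤ 1) (ht : t ∈ Icc (-R) R) :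
    ‖(e : ℂ) + t * Complex.I‖ ≤ R + 1 := by
  refine (norm_add_le _ _).trans ?_
  rw [norm_mul, Complex.norm_I, mul_one, Complex.norm_real, Complex.norm_real,
    Real.norm_of_nonneg he0.le, Real.norm_eq_abs]
  have := abs_le.2 ht
  linarith

theorem uniformCauchy (hT : IsHalfPlaneSemigroup T) (x : E) (R : ℝ) {ε : ℝ} (hε : 0 < ε) :
    ∃ δ > 0, ∀ e₁ e₂ : ℝ, 0 < e₁ → 0 < e₂ → e₁ < δ → e₂ < δ → ∀ t ∈ Icc (-R) R,
      ‖T (e₁ + t * Complex.I) x - T (e₂ + t * Complex.I) x‖ < ε := by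
  obtain ⟨δ, hδ, h⟩ := hT.exists_norm_sub_lt x (R + 1) hε
  refine ⟨min δ 1, by positivity, fun e₁ e₂ h1 h2 h1d h2d t ht => ?_⟩
  refine h _ _ (by simpa using h1) (by simpa using h2)
    (norm_add_mul_I_le h1 (h1d.le.trans (min_le_right _ _)) ht)
    (norm_add_mul_I_le h2 (h2d.le.trans (min_le_right _ _)) ht) ?_
  rw [add_sub_add_right_eq_sub, ← Complex.ofReal_sub, Complex.norm_real, Real.norm_eq_abs, abs_lt]
  have := min_le_left δ 1
  constructor <;> linarith

theorem exists_tendsto_boundary [CompleteSpace E] (hT : IsHalfPlaneSemigroup T) (x : E) (t : ℝ) :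
    ∃ y, Tendsto (fun e : ℝ => T (e + t * Complex.I) x) (𝓝[>] 0) (𝓝 y) := by
  rw [← cauchy_map_iff_exists_tendsto, Metric.cauchy_iff]
  refine ⟨inferInstance, fun ε hε => ?_⟩
  obtain ⟨δ, hδ, h⟩ := hT.uniformCauchy x |t| hε
  refine ⟨_, image_mem_map (Ioo_mem_nhdsGT hδ), ?_⟩
  rintro _ ⟨e₁, h1, rfl⟩ _ ⟨e₂, h2, rfl⟩
  rw [dist_eq_norm]
  exact h e₁ e₂ h1.1 h2.1 h1.2 h2.2 t (abs_le.1 le_rfl)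

/-- The boundary values of a semigroup on the imaginary axis. -/
def boundary [CompleteSpace E] (hT : IsHalfPlaneSemigroup T) (t : ℝ) : E →L[ℂ] E :=
  LinearMap.mkContinuousOfExistsBound
    { toFun := fun x => (hT.exists_tendsto_boundary x t).choose
      map_add' := fun x y => by
        refine tendsto_nhds_unique (hT.exists_tendsto_boundary (x + y) t).choose_spec ?_
        simp_rw [ContinuousLinearMap.map_add]
        exact (hT.exists_tendsto_boundary x t).choose_spec.add
          (hT.exists_tendsto_boundary y t).choose_spec
      map_smul' := fun c x => by
        refine tendsto_nhds_unique (hT.exists_tendsto_boundary (c • x) t).choose_spec ?_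
        simp_rw [map_smul]
        exact (hT.exists_tendsto_boundary x t).choose_spec.const_smul c }
    (by
      obtain ⟨C, _, hC⟩ := hT.exists_bound (|t| + 1)
      refine ⟨C, fun x => ?_⟩
      refine le_of_tendsto (hT.exists_tendsto_boundary x t).choose_spec.norm ?_
      filter_upwards [Ioc_mem_nhdsGT one_pos] with e he
      refine (T _).le_of_opNorm_le (hC _ (by simpa using he.1) ?_) x
      exact norm_add_mul_I_le he.1 he.2 (abs_le.1 le_rfl))

theorem tendsto_boundary [CompleteSpace E] (hT : IsHalfPlaneSemigroup T) (t : ℝ) (x : E) :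
    Tendsto (fun e : ℝ => T (e + t * Complex.I) x) (𝓝[>] 0) (𝓝 (hT.boundary t x)) :=
  (hT.exists_tendsto_boundary x t).choose_spec

theorem tendstoUniformlyOn_boundary [CompleteSpace E] (hT : IsHalfPlaneSemigroup T) (x : E)
    (R : ℝ) :
    TendstoUniformlyOn (fun (e : ℝ) (t : ℝ) => T (e + t * Complex.I) x)
      (fun t => hT.boundary t x) (𝓝[>] 0) (Icc (-R) R) := by
  rw [Metric.tendstoUniformlyOn_iff]
  intro ε hε
  obtain ⟨δ, hδ, h⟩ := hT.uniformCauchy x R (half_pos hε)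
  filter_upwards [Ioo_mem_nhdsGT hδ] with e he t ht
  rw [dist_eq_norm]
  refine lt_of_le_of_lt ?_ (half_lt_self hε)
  refine le_of_tendsto (((hT.tendsto_boundary t x).sub tendsto_const_nhds).norm) ?_
  filter_upwards [Ioo_mem_nhdsGT hδ] with e' he'
  exact (h e' e he'.1 he.1 he'.2 he.2 t ht).le

theorem isC0Group_boundary [CompleteSpace E] (hT : IsHalfPlaneSemigroup T) :
    IsC0Group hT.boundary where
  map_zero := by
    ext x
    refine tendsto_nhds_unique (hT.tendsto_boundary 0 x) ?_
    simpa using hT.tendsto x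
  map_add s t := by
    ext x
    obtain ⟨C, hC0, hC⟩ := hT.exists_bound (|s| + 1)
    have h1 : Tendsto (fun e : ℝ => T (e + s * Complex.I) (T (e + t * Complex.I) x)) (𝓝[>] 0)
        (𝓝 (hT.boundary s (hT.boundary t x))) := by
      -- Strong limits can be composed because the outer operators are uniformly bounded.
      have h2 : Tendsto (fun e : ℝ => T (e + s * Complex.I)
          (T (e + t * Complex.I) x - hT.boundary t x)) (𝓝[>] 0) (𝓝 0) := by
        have h3 := (tendsto_iff_norm_sub_tendsto_zero.1 (hT.tendsto_boundary t x)).const_mul C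
        rw [mul_zero] at h3
        refine squeeze_zero_norm' ?_ h3
        filter_upwards [Ioc_mem_nhdsGT one_pos] with e he
        refine (T _).le_of_opNorm_le (hC _ (by simpa using he.1) ?_) _
        exact norm_add_mul_I_le he.1 he.2 (abs_le.1 le_rfl)
      simpa using h2.add (hT.tendsto_boundary s (hT.boundary t x))
    refine tendsto_nhds_unique ?_ h1
    -- The product of the operators at `e + is` and `e + it` is the one at `2e + i(s + t)`.
    have h4 : Tendsto (fun e : ℝ => e + e) (𝓝[>] 0) (𝓝[>] 0) := by
      refine tendsto_nhdsWithin_iff.2 ⟨?_, ?_⟩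
      · have : Continuous fun e : ℝ => e + e := by fun_prop
        have h5 := this.tendsto 0
        rw [add_zero] at h5
        exact h5.mono_left nhdsWithin_le_nhds
      · filter_upwards [self_mem_nhdsWithin] with e he
        exact add_pos (mem_Ioi.1 he) (mem_Ioi.1 he)
    refine ((hT.tendsto_boundary (s + t) x).comp h4).congr' ?_
    filter_upwards [self_mem_nhdsWithin] with e he
    have he' : 0 < e := he
    rw [Function.comp_apply, ← ContinuousLinearMap.comp_apply,
      ← hT.map_add _ _ (by simpa using he') (by simpa using he')]
    congr 2
    push_cast
    ring
  continuous x := by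
    rw [continuous_iff_continuousAt]
    intro t
    have h1 : ContinuousOn (fun t => hT.boundary t x) (Icc (-(|t| + 1)) (|t| + 1)) := by
      refine (hT.tendstoUniformlyOn_boundary x (|t| + 1)).continuousOn ?_
      refine Eventually.frequently ?_
      filter_upwards [self_mem_nhdsWithin] with e he
      have he' : 0 < e := he
      refine Continuous.continuousOn (continuous_iff_continuousAt.2 fun s => ?_)
      have h2 : ContinuousAt (fun z => T z x) ((e : ℂ) + s * Complex.I) :=
        (hT.differentiableAt _ (by simpa using he')).continuousAt.clm_apply continuousAt_const
      exact ContinuousAt.comp (f := fun s : ℝ => (e : ℂ) + s * Complex.I) h2 (by fun_prop)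
    refine h1.continuousAt (Icc_mem_nhds ?_ ?_)
    · linarith [neg_abs_le t]
    · linarith [le_abs_self t]

/-! ### The generator of the boundary group -/

theorem hasDerivAt_orbit (hT : IsHalfPlaneSemigroup T) {z : ℂ} (hz : 0 < z.re) (x : E) :
    HasDerivAt (fun z => T z x) (deriv T z x) z :=
  (ContinuousLinearMap.apply ℂ E x).hasFDerivAt.comp_hasDerivAt z
    (hT.differentiableAt z hz).hasDerivAt

/-- Differentiability of an orbit along a ray, in terms of difference quotients. -/
theorem tendsto_slope_orbit (hT : IsHalfPlaneSemigroup T) {z : ℂ} (hz : 0 < z.re) (x : E) (c : ℂ) :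
    Tendsto (fun r : ℝ => ((r⁻¹ : ℝ) : ℂ) • (T (z + r * c) x - T z x)) (𝓝[≠] 0)
      (𝓝 (c • deriv T z x)) := by
  have h1 : HasDerivAt (fun r : ℝ => z + r * c) c 0 := by
    simpa using ((hasDerivAt_id (0 : ℝ)).ofReal_comp.mul_const c).const_add z
  have h2 : HasDerivAt (fun z => T z x) (deriv T z x) (z + (0 : ℝ) * c) := by
    simpa using hT.hasDerivAt_orbit hz x
  have h3 := (HasDerivAt.scomp (0 : ℝ) h2 h1).tendsto_slope_zero
  simp only [zero_add, Function.comp_apply, Complex.ofReal_zero, zero_mul, add_zero] at h3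
  exact h3.congr fun r => (Complex.coe_smul r⁻¹ _).symm

/-- The derivative of the orbit of `x` is the orbit of `y`. -/
def OrbitDeriv (T : ℂ → E →L[ℂ] E) (x y : E) : Prop := ∀ z : ℂ, 0 < z.re → deriv T z x = T z y

/-- Applying `T z` to the difference quotient at `0` gives the one at `z` along the real direction.
-/
theorem orbitDeriv_of_semigroupGeneratorApply (hT : IsHalfPlaneSemigroup T) {x y : E}
    (h : SemigroupGeneratorApply T x y) : OrbitDeriv T x y := by
  intro z hz
  have h1 := (hT.tendsto_slope_orbit hz x 1).mono_left
    (nhdsWithin_mono (0 : ℝ) (fun r (hr : r ∈ Ioi 0) => ne_of_gt hr))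
  rw [one_smul] at h1
  refine tendsto_nhds_unique h1 ((((T z).continuous.tendsto y).comp h).congr' ?_)
  filter_upwards [self_mem_nhdsWithin] with r hr
  have hr' : 0 < r := hr
  rw [Function.comp_apply, map_smul, map_sub, mul_one, hT.map_add z r hz (by simpa using hr'),
    ContinuousLinearMap.comp_apply]

theorem boundary_apply_map [CompleteSpace E] (hT : IsHalfPlaneSemigroup T) {z : ℂ} (hz : 0 < z.re)
    (t : ℝ) (x : E) : T z (hT.boundary t x) = T (z + t * Complex.I) x := by
  have h1 := ((T z).continuous.tendsto _).comp (hT.tendsto_boundary t x)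
  refine tendsto_nhds_unique h1 ?_
  have h2 : ContinuousAt (fun w => T w x) (z + t * Complex.I) :=
    (hT.differentiableAt _ (by simpa using hz)).continuousAt.clm_apply continuousAt_const
  have h3 : Tendsto (fun e : ℝ => (e : ℂ) + (z + t * Complex.I)) (𝓝[>] 0)
      (𝓝 (z + t * Complex.I)) := by
    have : Continuous fun e : ℝ => (e : ℂ) + (z + t * Complex.I) := by fun_prop
    have h4 := this.tendsto 0
    rw [Complex.ofReal_zero, zero_add] at h4
    exact h4.mono_left nhdsWithin_le_nhds
  refine (h2.tendsto.comp h3).congr' ?_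
  filter_upwards [self_mem_nhdsWithin] with e he
  have he' : 0 < e := he
  rw [Function.comp_apply, Function.comp_apply, ← ContinuousLinearMap.comp_apply,
    ← hT.map_add _ _ hz (by simpa using he')]
  congr 2
  ring

/-- Applying `T z` to the quotient of the group gives the slope at `z` in the direction `i`, which
by holomorphy is `i` times the complex derivative; then cancel `i`. -/
theorem orbitDeriv_of_groupGeneratorApply [CompleteSpace E] (hT : IsHalfPlaneSemigroup T)
    {x y : E} (h : GroupGeneratorApply hT.boundary x (Complex.I • y)) : OrbitDeriv T x y := by
  intro z hz
  have h1 := hT.tendsto_slope_orbit hz x Complex.I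
  have h2 : Complex.I • deriv T z x = Complex.I • T z y := by
    have h3 := ((T z).continuous.tendsto _).comp h
    rw [map_smul] at h3
    refine tendsto_nhds_unique h1 (h3.congr fun t => ?_)
    rw [Function.comp_apply, map_smul, map_sub, hT.boundary_apply_map hz]
  exact smul_right_injective E Complex.I_ne_zero h2

/-- If the derivative of the orbit of `x` is the orbit of `y`, then `T(z) x = x + z y + o(z)`. -/
theorem exists_norm_sub_sub_le (hT : IsHalfPlaneSemigroup T) {x y : E} (h : OrbitDeriv T x y)
    {ε : ℝ} (hε : 0 < ε) :
    ∃ δ > 0, ∀ z : ℂ, 0 < z.re → ‖z‖ < δ → ‖T z x - x - z • y‖ ≤ ε * ‖z‖ := by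
  obtain ⟨δ, hδ, h1⟩ := Metric.tendsto_nhdsWithin_nhds.1 (hT.tendsto_halfPlane y) ε hε
  refine ⟨δ, hδ, fun z hz hzδ => ?_⟩
  have hconv : Convex ℝ (Metric.ball (0 : ℂ) δ ∩ {z : ℂ | 0 < z.re}) :=
    (convex_ball _ _).inter (convex_halfSpace_re_gt 0)
  -- The function `T w x - w y` has derivative `T w y - y`, of norm below `ε` on a convex half disc.
  -- The point `0` lies outside the domain, so the base point is `r`, sent to `0` afterwards.
  have hmvt : ∀ r : ℝ, 0 < r → r < δ → ‖(T z x - z • y) - (T r x - (r : ℂ) • y)‖ ≤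
      ε * ‖z - r‖ := by
    intro r hr hrδ
    refine hconv.norm_image_sub_le_of_norm_hasDerivWithin_le (𝕜 := ℂ)
      (f := fun z => T z x - z • y) (f' := fun z => T z y - y)
      (fun w hw => ?_) (fun w hw => ?_) ⟨?_, ?_⟩ ⟨?_, hz⟩
    · have h2 := hT.hasDerivAt_orbit hw.2 x
      rw [h w hw.2] at h2
      have h3 := h2.sub ((hasDerivAt_id w).smul_const y)
      simp only [one_smul] at h3
      exact h3.hasDerivWithinAt
    · have h2 := h1 hw.2 hw.1
      rw [dist_eq_norm] at h2
      exact h2.le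
    · rwa [mem_ball_zero_iff, Complex.norm_real, Real.norm_of_nonneg hr.le]
    · simpa using hr
    · rwa [mem_ball_zero_iff]
  have hid : Tendsto (fun r : ℝ => (r : ℂ)) (𝓝[>] 0) (𝓝 0) := by
    have h5 := Complex.continuous_ofReal.tendsto 0
    rw [Complex.ofReal_zero] at h5
    exact h5.mono_left nhdsWithin_le_nhds
  have hl : Tendsto (fun r : ℝ => ‖(T z x - z • y) - (T r x - (r : ℂ) • y)‖) (𝓝[>] 0)
      (𝓝 ‖(T z x - z • y) - (x - (0 : ℂ) • y)‖) :=
    (tendsto_const_nhds.sub ((hT.tendsto x).sub (hid.smul_const y))).norm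
  have hr : Tendsto (fun r : ℝ => ε * ‖z - (r : ℂ)‖) (𝓝[>] 0) (𝓝 (ε * ‖z - 0‖)) :=
    ((tendsto_const_nhds.sub hid).norm).const_mul ε
  have h6 : T z x - x - z • y = (T z x - z • y) - (x - (0 : ℂ) • y) := by
    rw [zero_smul]; abel
  rw [h6]
  rw [sub_zero z] at hr
  refine le_of_tendsto_of_tendsto hl hr ?_
  filter_upwards [Ioo_mem_nhdsGT hδ] with r hr
  exact hmvt r hr.1 hr.2

theorem norm_inv_smul_sub_le {r ε : ℝ} (hr : r ≠ 0) {v y : E}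
    (h : ‖v - (r : ℂ) • y‖ ≤ ε * |r|) : ‖((r⁻¹ : ℝ) : ℂ) • v - y‖ ≤ ε := by
  have hrc : (r : ℂ) ≠ 0 := Complex.ofReal_ne_zero.2 hr
  have h1 : ((r⁻¹ : ℝ) : ℂ) • v - y = ((r⁻¹ : ℝ) : ℂ) • (v - (r : ℂ) • y) := by
    rw [smul_sub, smul_smul, Complex.ofReal_inv, inv_mul_cancel₀ hrc, one_smul]
  have hr' : 0 < |r| := abs_pos.2 hr
  rw [h1, norm_smul, Complex.norm_real, Real.norm_eq_abs, abs_inv]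
  calc |r|⁻¹ * ‖v - (r : ℂ) • y‖ ≤ |r|⁻¹ * (ε * |r|) := by gcongr
    _ = ε := by field_simp

theorem semigroupGeneratorApply_of_orbitDeriv (hT : IsHalfPlaneSemigroup T) {x y : E}
    (h : OrbitDeriv T x y) : SemigroupGeneratorApply T x y := by
  rw [SemigroupGeneratorApply, Metric.tendsto_nhds]
  intro ε hε
  obtain ⟨δ, hδ, h1⟩ := hT.exists_norm_sub_sub_le h (half_pos hε)
  filter_upwards [Ioo_mem_nhdsGT hδ] with r hr
  rw [dist_eq_norm]
  refine lt_of_le_of_lt (norm_inv_smul_sub_le hr.1.ne' ?_) (half_lt_self hε)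
  have h2 := h1 r (by simpa using hr.1) (by
    rw [Complex.norm_real, Real.norm_of_nonneg hr.1.le]; exact hr.2)
  rwa [Complex.norm_real, Real.norm_eq_abs] at h2

theorem groupGeneratorApply_of_orbitDeriv [CompleteSpace E] (hT : IsHalfPlaneSemigroup T)
    {x y : E} (h : OrbitDeriv T x y) : GroupGeneratorApply hT.boundary x (Complex.I • y) := by
  rw [GroupGeneratorApply, Metric.tendsto_nhds]
  intro ε hε
  obtain ⟨δ, hδ, h1⟩ := hT.exists_norm_sub_sub_le h (half_pos hε)
  have hsmall : ∀ᶠ t : ℝ in 𝓝[≠] 0, |t| < δ := by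
    refine nhdsWithin_le_nhds ?_
    filter_upwards [Metric.ball_mem_nhds (0 : ℝ) hδ] with t ht
    simpa using ht
  filter_upwards [self_mem_nhdsWithin, hsmall] with t ht0 htδ
  rw [dist_eq_norm]
  refine lt_of_le_of_lt (norm_inv_smul_sub_le ht0 ?_) (half_lt_self hε)
  have hc : Tendsto (fun e : ℝ => (e : ℂ) + t * Complex.I) (𝓝[>] 0) (𝓝 (t * Complex.I)) := by
    have : Continuous fun e : ℝ => (e : ℂ) + t * Complex.I := by fun_prop
    have h4 := this.tendsto 0
    rw [Complex.ofReal_zero, zero_add] at h4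
    exact h4.mono_left nhdsWithin_le_nhds
  have hn : ‖(t : ℂ) * Complex.I‖ = |t| := by
    rw [norm_mul, Complex.norm_I, mul_one, Complex.norm_real, Real.norm_eq_abs]
  rw [smul_smul, ← hn]
  -- The first-order expansion holds at `e + it` for every small `e > 0`, and passes to the boundary
  -- as `e → 0`.
  refine le_of_tendsto_of_tendsto
    (((hT.tendsto_boundary t x).sub_const x).sub (hc.smul_const y)).norm
    (hc.norm.const_mul (ε / 2)) ?_
  have hlt := hc.norm.eventually_lt_const (u := δ) (by rwa [hn])
  filter_upwards [self_mem_nhdsWithin, hlt] with e he hlt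
  have he' : 0 < e := he
  exact h1 _ (by simpa using he') hlt

theorem isBoundaryGroup_boundary [CompleteSpace E] (hT : IsHalfPlaneSemigroup T) :
    IsBoundaryGroup T hT.boundary where
  isC0Group := hT.isC0Group_boundary
  tendstoUniformlyOn := hT.tendstoUniformlyOn_boundary
  generator x y := by
    constructor
    · intro h
      have hy : y = Complex.I • (-Complex.I • y) := by
        rw [smul_smul, mul_neg, Complex.I_mul_I, neg_neg, one_smul]
      rw [hy] at h
      exact ⟨_, hT.semigroupGeneratorApply_of_orbitDeriv
        (hT.orbitDeriv_of_groupGeneratorApply h), hy⟩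
    · rintro ⟨y', h, rfl⟩
      exact hT.groupGeneratorApply_of_orbitDeriv (hT.orbitDeriv_of_semigroupGeneratorApply h)

end IsHalfPlaneSemigroup

/-! ### Restriction of holomorphic families to an invariant subspace -/

/-- The derivative preserves `p`, as a strong limit of difference quotients that do and because `p`
is closed. Restricting the remainder to `p` does not increase its operator norm. -/
theorem differentiableAt_of_invariant {E : Type*} [NormedAddCommGroup E] [NormedSpace ℂ E]
    {p : Submodule ℂ E} (hp : IsClosed (p : Set E)) {J : ℂ → E →L[ℂ] E} {T : ℂ → p →L[ℂ] p}
    {z : ℂ} (hJ : DifferentiableAt ℂ J z) (hT : ∀ᶠ w in 𝓝 z, ∀ x : p, (T w x : E) = J w x) :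
    DifferentiableAt ℂ T z := by
  have hD := hJ.hasDerivAt
  have hinv : ∀ x ∈ p, deriv J z x ∈ p := by
    intro x hx
    have h1 := (hasDerivAt_iff_tendsto_slope_zero.1 
      ((ContinuousLinearMap.apply ℂ E x).hasFDerivAt.comp_hasDerivAt z hD))
    refine hp.mem_of_tendsto h1 ?_
    have h2 : ∀ᶠ h : ℂ in 𝓝[≠] 0, ∀ x : p, (T (z + h) x : E) = J (z + h) x := by
      refine nhdsWithin_le_nhds ?_
      have h3 : Tendsto (fun h : ℂ => z + h) (𝓝 0) (𝓝 z) := by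
        have : Continuous fun h : ℂ => z + h := by fun_prop
        simpa using this.tendsto 0
      exact h3.eventually hT
    filter_upwards [h2] with h h4
    refine p.smul_mem _ (p.sub_mem ?_ ?_)
    · exact (congrArg (· ∈ p) (h4 ⟨x, hx⟩)).mp (T (z + h) ⟨x, hx⟩).2
    · exact (congrArg (· ∈ p) (hT.self_of_nhds ⟨x, hx⟩)).mp (T z ⟨x, hx⟩).2
  let D : p →L[ℂ] p := ((deriv J z).comp p.subtypeL).codRestrict p fun x => hinv x x.2
  rw [hasDerivAt_iff_isLittleO] at hD
  have key : (fun w => T w - T z - (w - z) • D) =o[𝓝 z] fun w => w - z := by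
    refine Asymptotics.IsBigO.trans_isLittleO (Asymptotics.IsBigO.of_bound 1 ?_) hD
    filter_upwards [hT] with w hw
    rw [one_mul]
    refine ContinuousLinearMap.opNorm_le_bound _ (norm_nonneg _) fun x => ?_
    refine le_trans (le_of_eq ?_) ((J w - J z - (w - z) • deriv J z).le_opNorm (x : E))
    rw [← Submodule.norm_coe]
    congr 1
    change (T w x : E) - (T z x : E) - (w - z) • deriv J z x = _
    rw [hw, hT.self_of_nhds]
    rfl
  exact ((hasDerivAt_iff_isLittleO (F := p →L[ℂ] p) (f := T) (f' := D) (x := z)).2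
    key).differentiableAt

/-! ### Fractional integration on the little Hölder space -/

namespace LipZero

variable {α : ℝ≥0}

/-- The part of fractional integration in the little Hölder space, for `0 < Re z`. -/
def littleFracInt (hα : 0 < α) (hα1 : α < 1) (z : ℂ) : littleLipZero α →L[ℂ] littleLipZero α :=
  if hz : 0 < z.re then
    ((fracInt hα z).comp (littleLipZero α).subtypeL).codRestrict (littleLipZero α)
      fun f => fracInt_mem_littleLipZero hα hα1 hz f
  else 0

theorem coe_littleFracInt (hα : 0 < α) (hα1 : α < 1) {z : ℂ} (hz : 0 < z.re)
    (f : littleLipZero α) :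
    (littleFracInt hα hα1 z f : LipZero α) = fracInt hα z f := by
  rw [littleFracInt, dif_pos hz]
  rfl

theorem norm_littleFracInt_le (hα : 0 < α) (hα1 : α < 1) {z : ℂ} (hz : 0 < z.re) :
    ‖littleFracInt hα hα1 z‖ ≤ ‖fracInt hα z‖ := by
  refine ContinuousLinearMap.opNorm_le_bound _ (norm_nonneg _) fun f => ?_
  rw [← Submodule.norm_coe, coe_littleFracInt hα hα1 hz]
  exact (fracInt hα z).le_opNorm (f : LipZero α)

instance : CompleteSpace (littleLipZero α) := isClosed_littleLipZero.completeSpace_coe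

theorem isHalfPlaneSemigroup_littleFracInt (hα : 0 < α) (hα1 : α < 1) :
    IsHalfPlaneSemigroup (littleFracInt hα hα1) where
  map_add z w hz hw := by
    have hzw : 0 < (z + w).re := by rw [Complex.add_re]; positivity
    refine ContinuousLinearMap.ext fun f => Subtype.ext ?_
    rw [coe_littleFracInt hα hα1 hzw, ContinuousLinearMap.comp_apply,
      coe_littleFracInt hα hα1 hz, coe_littleFracInt hα hα1 hw, fracInt_add hα hz hw]
    rfl
  differentiableAt z hz := by
    refine differentiableAt_of_invariant isClosed_littleLipZero (differentiableAt_fracInt hα hz) ?_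
    filter_upwards [(isOpen_lt continuous_const Complex.continuous_re).mem_nhds hz] with w hw f
    exact coe_littleFracInt hα hα1 hw f
  bound R := by
    obtain ⟨C, hC⟩ := exists_norm_fracInt_le_of_norm_le_radius hα hα1 R
    exact ⟨C, fun z hz hzR => (norm_littleFracInt_le hα hα1 hz).trans (hC z hz hzR)⟩
  tendsto f := by
    rw [tendsto_subtype_rng]
    refine (tendsto_fracInt_of_mem_littleLipZero hα f.2).congr' ?_
    filter_upwards [self_mem_nhdsWithin] with r hr
    exact (coe_littleFracInt hα hα1 (by simpa using hr) f).symm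

theorem isHolomorphicC0Semigroup_littleFracInt (hα : 0 < α) (hα1 : α < 1) :
    IsHolomorphicC0Semigroup (Real.pi / 2) (littleFracInt hα hα1) where
  map_add z hz w hw := (isHalfPlaneSemigroup_littleFracInt hα hα1).map_add z w
    (mem_openSector_pi_div_two.1 hz) (mem_openSector_pi_div_two.1 hw)
  differentiableOn z hz := ((isHalfPlaneSemigroup_littleFracInt hα hα1).differentiableAt z
    (mem_openSector_pi_div_two.1 hz)).differentiableWithinAt
  bound θ h0 hθ := by
    obtain ⟨M, ω, hω, h⟩ := (isHolomorphicSemigroup_fracInt hα hα1).bound θ h0 hθ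
    exact ⟨M, ω, hω, fun z hz =>
      (norm_littleFracInt_le hα hα1 (re_pos_of_mem_openSector hθ hz)).trans (h z hz)⟩
  tendsto_zero θ _ hθ f := ((isHalfPlaneSemigroup_littleFracInt hα hα1).tendsto_halfPlane f).mono_left
    (nhdsWithin_mono _ fun _ hz => re_pos_of_mem_openSector hθ hz)

end LipZero

/-- For `0 < α < 1`: fractional integration on `Lip_0^α[0,1]` and `lip_0^α[0,1]`. -/
theorem theorem4p2 (α : ℝ≥0) (hα0 : 0 < α) (hα1 : α < 1) :
    ∃ J : ℂ → LipZero α →L[ℂ] LipZero α,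
      -- `J(z)` is the Riemann–Liouville fractional integral of order `z`
      (∀ z : ℂ, 0 < z.re → ∀ (f : LipZero α) (t : I), J z f t = riemannLiouville z f t) ∧
      -- holomorphic semigroup of angle `π / 2`, strongly continuous at `0` exactly on `lip_0^α`
      IsHolomorphicSemigroup (Real.pi / 2) J ∧
      (∀ f : LipZero α,
        Tendsto (fun r : ℝ => J r f) (𝓝[>] 0) (𝓝 f) ↔ f ∈ littleLipZero α) ∧
      -- uniform bounds near the imaginary axis
      BddAbove ((fun z => ‖J z‖) '' upperQuarterDisc) ∧
      BddAbove ((fun z => ‖J z‖) '' lowerQuarterDisc) ∧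
      (∀ z : ℂ, 0 < z.re → ‖z‖ ≤ (1 - (α : ℝ)) / 2 →
        ‖J z‖ ≤ ‖Complex.Gamma z‖⁻¹ * (5 / (α : ℝ) + 2 * ‖z - 1‖ / (1 - (α : ℝ))) +
          (1 + (2 : ℝ) ^ (1 + (α : ℝ))) * ‖Complex.Gamma (z + 1)‖⁻¹) ∧
      -- the part of `J` in `lip_0^α` and its boundary group
      ∃ T : ℂ → littleLipZero α →L[ℂ] littleLipZero α,
        (∀ z : ℂ, 0 < z.re → ∀ f : littleLipZero α, (T z f : LipZero α) = J z f) ∧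
        IsHolomorphicC0Semigroup (Real.pi / 2) T ∧
        ∃ U : ℝ → littleLipZero α →L[ℂ] littleLipZero α, IsBoundaryGroup T U := by
  -- The bound holds on the whole right half of the unit disc, which contains both quarter discs.
  obtain ⟨C, hC⟩ := LipZero.exists_norm_fracInt_le_of_norm_le_radius hα0 hα1 1
  refine ⟨LipZero.fracInt hα0, fun z hz => LipZero.fracInt_eq_riemannLiouville hα0 hz,
    LipZero.isHolomorphicSemigroup_fracInt hα0 hα1, LipZero.tendsto_fracInt_iff hα0 hα1,
    ⟨C, ?_⟩, ⟨C, ?_⟩, fun z hz hz1 => LipZero.norm_fracInt_le_of_norm_le hα0 hα1 hz hz1,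
    LipZero.littleFracInt hα0 hα1, fun z hz => LipZero.coe_littleFracInt hα0 hα1 hz,
    LipZero.isHolomorphicC0Semigroup_littleFracInt hα0 hα1, _,
    (LipZero.isHalfPlaneSemigroup_littleFracInt hα0 hα1).isBoundaryGroup_boundary⟩
  · rintro _ ⟨z, hz, rfl⟩
    exact hC z hz.1 hz.2.2
  · rintro _ ⟨z, hz, rfl⟩
    exact hC z hz.1 hz.2.2

end
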